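/- Let $m\ge 1$, $0<q<1$, $Q=q^2$, $\lambda_Q=(1-Q)^{-1/2}$, and $[u]_q=\frac{q^u-1}{q-1}$, $[n]_q!=[n]_q\cdots[1]_q$, $e_q(t)=\sum_{j\ge0}q^{j(j-1)/2}\frac{t^j}{[j]_q!}$, $\Gamma_q(t)=(1-q)^{1-t}\prod_{k\ge1}(1-q^k)\big/\prod_{k\ge0}(1-q^{t+k})$, $\int_0^a f(t)\,d_qt=(1-q)a\sum_{k\ge0}f(aq^k)q^k$. Let $\mathbb{R}_{0,m}$ be the Clifford algebra with generators $e_1,\dots,e_m$, $e_ie_j+e_je_i=-2\delta_{ij}$, main anti-involution $a\mapsto\overline a$ ($\overline{e_i}=-e_i$, $\overline{ab}=\overline b\,\overline a$) and scalar part $[\cdot]_0$. On $\mathcal P=\mathbb{R}[x_1,\dots,x_m]\otimes\mathbb{R}_{0,m}$ put $\underline x=\sum_j e_jx_j$, $\partial_{\underline x}=-\sum_j e_j\partial_{x_j}$, $\mathbb E=\sum_j x_j\partial_{x_j}$. The $q$-Dirac operator is $\partial^q_{\underline x}=\frac1{\underline x}[\underline x\,\partial_{\underline x}]_q$, where $[A]_q=\frac{q^A-1}{q-1}$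 and $q^A=\sum_n\frac{(\ln q)^n}{n!}A^n$, and $\Delta_q=-(\partial^q_{\underline x})^2$. Let $\mathcal M_k=\{F\in\mathcal P:\partial_{\underline x}F=0,\ \mathbb EF=kF\}$ be the space of spherical monogenics of degree $k$. The $q$-Clifford-Hermite polynomial $H^q_{j,m,k}(\underline x)=\sum_{i=0}^{\lfloor j/2\rfloor}a_i\,\underline x^{\,j-2i}$ has $a_i\in\mathbb R$, $a_0=(q+1)^j$, and is such that, for some $\lambda\in\mathbb{R}$ and all $M_k\in\mathcal M_k$, the function $f=H^q_{j,m,k}(\underline x)M_k$ satisfies $$[\Delta_q-(q+1)\underline x\,\partial^q_{\underline x}]f(\underline x)=-(q+1)\lambda f(q\underline x).$$ For each $k$ let $(M_k^{(p)})_p$ be a finite family in $\mathcal M_k$ (for instance a basis) that is orthonormal for $\int_{\mathbb S^{m-1}}d\xi\,[\overline F\,G]_0$, with $d\xi$ the surface measure. For $F,G\in\mathcal P$ let $$\langle F|G\rangle=\int_{\mathbb S^{m-1}}d\xi\int_0^{\lambda_Q}d_qr\;r^{m-1}\left[\overline F\,G\,e_Q(\underline x^2)\right]_0(r\xi),\qquad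 \underline x^2=-r^2 .$$ Theorem. All the expressions $\langle F|G\rangle$ converge, polynomials $H^q_{j,m,k}$ as above exist for all $j,k\ge 0$, and, with $\beta=\frac m2+k$, for all $j,t,k,l\ge0$, all $p,r$ and for $n=l$ (and equally for $n=k$), $$\langle H^q_{2j,m,k}M_k^{(p)}|H^q_{2t,m,n}M_l^{(r)}\rangle=\delta_{jt}\delta_{kl}\delta_{pr}\,(q+1)^{4j-1}Q^{(j+1)(j+\beta)}[j]_Q!\,\Gamma_Q(j+\beta),$$ $$\langle H^q_{2j+1,m,k}M_k^{(p)}|H^q_{2t+1,m,n}M_l^{(r)}\rangle=\delta_{jt}\delta_{kl}\delta_{pr}\,(q+1)^{4j+1}Q^{(j+1)(j+\beta+1)}[j]_Q!\,\Gamma_Q(j+\beta+1),$$ $$\langle H^q_{2j+1,m,k}M_k^{(p)}|H^q_{2t,m,n}M_l^{(r)}\rangle=0 .$$ -/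

import Mathlib

open scoped TensorProduct

namespace QClifford

noncomputable section

/-! ### Quantum numbers, exponential, Gamma function, Jackson integral -/

/-- The `q`-number `[u]_q = (q ^ u - 1) / (q - 1)`. -/
def qNum (q u : ℝ) : ℝ := (q ^ u - 1) / (q - 1)

/-- The `q`-factorial `[n]_q! = [n]_q [n-1]_q ⋯ [1]_q`. -/
def qFactorial (q : ℝ) (n : ℕ) : ℝ := ∏ i ∈ Finset.range n, qNum q ((i : ℝ) + 1)

/-- The `q`-exponential `e_q(t) = ∑_j q ^ (j (j - 1) / 2) t ^ j / [j]_q!`. -/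
def qExp (q t : ℝ) : ℝ := ∑' j : ℕ, q ^ (j * (j - 1) / 2) * t ^ j / qFactorial q j

/-- The `q`-Gamma function, for `0 < q < 1`. -/
def qGamma (q t : ℝ) : ℝ :=
  (∏' k : ℕ, (1 - q ^ (k + 1))) / (∏' k : ℕ, (1 - q ^ (t + (k : ℝ)))) * (1 - q) ^ (1 - t)

/-- The Jackson integral `∫_0^a f(t) d_q t = (1 - q) a ∑_k f(a q ^ k) q ^ k`. -/
def jackson (q a : ℝ) (f : ℝ → ℝ) : ℝ := (1 - q) * a * ∑' k : ℕ, f (a * q ^ k) * q ^ k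

/-! ### `q`-integration over balls -/

/-- The `q`-integral over the ball of radius `R`:
`∫_{S^{m-1}} dξ ∫_0^R d_q r r ^ (m - 1) f(r ξ)`, with `dξ` the surface measure. -/
def qBallIntegral (q : ℝ) (m : ℕ) (R : ℝ) (f : EuclideanSpace ℝ (Fin m) → ℝ) : ℝ :=
  ∫ ξ : Metric.sphere (0 : EuclideanSpace ℝ (Fin m)) 1,
    jackson q R (fun r => r ^ (m - 1) * f (r • (ξ : EuclideanSpace ℝ (Fin m))))
    ∂(MeasureTheory.volume : MeasureTheory.Measure (EuclideanSpace ℝ (Fin m))).toSphere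

/-- The series and the integral over the sphere in `qBallIntegral` converge (absolutely). -/
def QBallIntegrable (q : ℝ) (m : ℕ) (R : ℝ) (f : EuclideanSpace ℝ (Fin m) → ℝ) : Prop :=
  (∀ ξ : Metric.sphere (0 : EuclideanSpace ℝ (Fin m)) 1,
    Summable fun k : ℕ =>
      (R * q ^ k) ^ (m - 1) * f ((R * q ^ k) • (ξ : EuclideanSpace ℝ (Fin m))) * q ^ k) ∧
  MeasureTheory.Integrable
    (fun ξ : Metric.sphere (0 : EuclideanSpace ℝ (Fin m)) 1 =>
      jackson q R (fun r => r ^ (m - 1) * f (r • (ξ : EuclideanSpace ℝ (Fin m)))))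
    (MeasureTheory.volume : MeasureTheory.Measure (EuclideanSpace ℝ (Fin m))).toSphere

/-! ### The Clifford algebra and Clifford-valued polynomials -/

/-- The quadratic form `v ↦ -∑ v_i ^ 2` on `ℝ^m`. -/
def negForm (m : ℕ) : QuadraticForm ℝ (Fin m → ℝ) :=
  QuadraticMap.weightedSumSquares ℝ (fun _ : Fin m => (-1 : ℝ))

/-- The Clifford algebra `ℝ_{0,m}`, with `e_i e_j + e_j e_i = -2 δ_ij`. The main anti-involution
(`e_i ↦ -e_i`, reversing products) is its `star`. -/
abbrev Cl (m : ℕ) : Type := CliffordAlgebra (negForm m)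

/-- The generator `e_i`. -/
def gen (m : ℕ) (i : Fin m) : Cl m := CliffordAlgebra.ι (negForm m) (Pi.single i 1)

/-- The projection `[·]_0` onto the scalar part, through the identification of the Clifford
algebra with the exterior algebra, which sends `e_{i_1} ⋯ e_{i_r}` to
`e_{i_1} ∧ ⋯ ∧ e_{i_r}` for `i_1 < ⋯ < i_r`. -/
def scalarPart (m : ℕ) (a : Cl m) : ℝ :=
  ExteriorAlgebra.algebraMapInv (CliffordAlgebra.equivExterior (negForm m) a)

/-- The algebra `𝒫 = ℝ[x_1, …, x_m] ⊗ ℝ_{0,m}` of Clifford-valued polynomials. -/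
abbrev CPoly (m : ℕ) : Type := MvPolynomial (Fin m) ℝ ⊗[ℝ] Cl m

/-- The value of a Clifford-valued polynomial at a point. -/
def evalAt (m : ℕ) (y : EuclideanSpace ℝ (Fin m)) : CPoly m →ₐ[ℝ] Cl m :=
  (Algebra.TensorProduct.lid ℝ (Cl m)).toAlgHom.comp
    (Algebra.TensorProduct.map (MvPolynomial.aeval fun i => y i) (AlgHom.id ℝ (Cl m)))

/-- The vector variable `x = ∑ e_j x_j`. -/
def vecVar (m : ℕ) : CPoly m := ∑ j : Fin m, MvPolynomial.X j ⊗ₜ[ℝ] gen m j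

/-- The partial derivative with respect to `x_j` on Clifford-valued polynomials. -/
def partialD (m : ℕ) (j : Fin m) : CPoly m →ₗ[ℝ] CPoly m :=
  TensorProduct.map (MvPolynomial.pderiv j).toLinearMap LinearMap.id

/-- The Dirac operator `∂ = -∑ e_j ∂_{x_j}`. -/
def dirac (m : ℕ) : CPoly m →ₗ[ℝ] CPoly m :=
  -∑ j : Fin m, LinearMap.mulLeft ℝ ((1 : MvPolynomial (Fin m) ℝ) ⊗ₜ[ℝ] gen m j) ∘ₗ partialD m j

/-- The Euler operator `𝔼 = ∑ x_j ∂_{x_j}`. -/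
def euler (m : ℕ) : CPoly m →ₗ[ℝ] CPoly m :=
  ∑ j : Fin m,
    LinearMap.mulLeft ℝ ((MvPolynomial.X j : MvPolynomial (Fin m) ℝ) ⊗ₜ[ℝ] (1 : Cl m)) ∘ₗ
      partialD m j

/-- The dilation `f(x) ↦ f(c x)`. -/
def dilate (m : ℕ) (c : ℝ) : CPoly m →ₐ[ℝ] CPoly m :=
  Algebra.TensorProduct.map
    (MvPolynomial.aeval fun i => MvPolynomial.C c * MvPolynomial.X i) (AlgHom.id ℝ (Cl m))

/-- `F` is a spherical monogenic of degree `k`. -/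
def IsSphericalMonogenic (m k : ℕ) (F : CPoly m) : Prop :=
  dirac m F = 0 ∧ euler m F = (k : ℝ) • F

/-- The inner product `∫_{S^{m-1}} dξ [conj(F) G]_0` on the unit sphere. -/
def sphereInner (m : ℕ) (F G : CPoly m) : ℝ :=
  ∫ ξ : Metric.sphere (0 : EuclideanSpace ℝ (Fin m)) 1,
    scalarPart m (star (evalAt m ξ F) * evalAt m ξ G)
    ∂(MeasureTheory.volume : MeasureTheory.Measure (EuclideanSpace ℝ (Fin m))).toSphere

/-! ### The `q`-Dirac and `q`-Laplace operators -/

/-- The coarsest topology for which all linear functionals are continuous; it is Hausdorff and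
induces the usual topology on every finite-dimensional subspace. -/
@[reducible] def weakTopology (V : Type) [AddCommGroup V] [Module ℝ V] : TopologicalSpace V :=
  ⨅ φ : V →ₗ[ℝ] ℝ, TopologicalSpace.induced φ inferInstance

/-- The operator `q ^ A = ∑_n (ln q) ^ n / n! A ^ n`, the series being summed pointwise. -/
def opPow {V : Type} [AddCommGroup V] [Module ℝ V] (q : ℝ) (A : Module.End ℝ V) (f : V) : V :=
  letI : TopologicalSpace V := weakTopology V
  ∑' n : ℕ, (Real.log q ^ n / (n.factorial : ℝ)) • (A ^ n) f

/-- The operator `[A]_q = (q ^ A - 1) / (q - 1)`. -/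
def opQNum {V : Type} [AddCommGroup V] [Module ℝ V] (q : ℝ) (A : Module.End ℝ V) (f : V) : V :=
  (q - 1)⁻¹ • (opPow q A f - f)

/-- The operator `x ∂ = 𝔼 + Γ` (vector variable times Dirac operator). -/
def vecDirac (m : ℕ) : Module.End ℝ (CPoly m) := LinearMap.mulLeft ℝ (vecVar m) ∘ₗ dirac m

/-- The `q`-Dirac operator `∂^q = (1 / x) [x ∂]_q`. Here `(1 / x) h` is the polynomial `g` with
`x g = h` (unique when it exists and `m ≥ 1`, because `x ^ 2 = -r ^ 2`). -/
def qDirac (m : ℕ) (q : ℝ) (f : CPoly m) : CPoly m :=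
  Function.invFun (fun g : CPoly m => vecVar m * g) (opQNum q (vecDirac m) f)

/-- The `q`-Laplace operator `Δ_q = -(∂^q) ^ 2`. -/
def qLaplace (m : ℕ) (q : ℝ) (f : CPoly m) : CPoly m := -qDirac m q (qDirac m q f)

/-! ### Clifford-Hermite polynomials and the inner product -/

/-- `H`, a real polynomial in one indeterminate (for which the vector variable is to be
substituted), is the `q`-Clifford-Hermite polynomial `H^q_{j,m,k}`:
`H = ∑_{i ≤ j/2} a_i X ^ (j - 2 i)` with `a_0 = (q + 1) ^ j`, and for all spherical monogenics `M`
of degree `k` the function `f = H(x) M` satisfies the `q`-Clifford-Hermite equation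
`[Δ_q - (q + 1) x ∂^q] f(x) = -(q + 1) lam f(q x)` for an eigenvalue `lam`. -/
def IsCliffordHermite (q : ℝ) (m j k : ℕ) (H : Polynomial ℝ) : Prop :=
  (∃ a : ℕ → ℝ, a 0 = (q + 1) ^ j ∧
    H = ∑ i ∈ Finset.range (j / 2 + 1), Polynomial.C (a i) * Polynomial.X ^ (j - 2 * i)) ∧
  ∃ lam : ℝ, ∀ M : CPoly m, IsSphericalMonogenic m k M →
    qLaplace m q (Polynomial.aeval (vecVar m) H * M)
        - (q + 1) • (vecVar m * qDirac m q (Polynomial.aeval (vecVar m) H * M))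
      = -((q + 1) * lam) • dilate m q (Polynomial.aeval (vecVar m) H * M)

/-- The radius `λ_Q = (1 / (1 - Q)) ^ (1/2)`, with `Q = q ^ 2`. -/
def lamQ (q : ℝ) : ℝ := Real.sqrt (1 / (1 - q ^ 2))

/-- The integrand `[conj(F) G e_Q(x ^ 2)]_0`, with `Q = q ^ 2` and `x ^ 2 = -r ^ 2`. -/
def qIntegrand (q : ℝ) (m : ℕ) (F G : CPoly m) (y : EuclideanSpace ℝ (Fin m)) : ℝ :=
  scalarPart m (star (evalAt m y F) * evalAt m y G *
    algebraMap ℝ (Cl m) (qExp (q ^ 2) (-‖y‖ ^ 2)))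

/-- The inner product `⟨F | G⟩`, the `q`-integral of `[conj(F) G e_Q(x ^ 2)]_0` over the ball of
radius `λ_Q`. -/
def qInner (q : ℝ) (m : ℕ) (F G : CPoly m) : ℝ :=
  qBallIntegral q m (lamQ q) (qIntegrand q m F G)

end

end QClifford

/-!
The functions `x ^ s M`, with `M` a spherical monogenic of degree `k`, are eigenvectors of `x ∂`
(`vecDirac_vecVar_pow_mul`): the eigenvalue is `s` for even `s` and `s + 2 k + m - 1` for odd `s`.
Hence the `q`-Dirac operator lowers the powers of `x` with `q`-number weights
(`qDirac_aeval_mul`), and the `q`-Clifford-Hermite equation for `H(x) M` becomes a two-term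
recursion on the coefficients of `H`. Writing `H = h(X ^ 2)` or `H = X h(X ^ 2)`, it is the
recursion of the little `q`-Laguerre polynomials in base `Q = q ^ 2` (`IsQLaguerre`) with parameter
`β = m / 2 + k` or `β + 1`. For `M ≠ 0` the functions `x ^ s M` are linearly independent, so that
the equation determines `H`.

The real polynomial `[conj(F) G]_0` is bilinear in `F` and `G`, and multiplication by `x` is
skew-adjoint for it. As `x ^ 2 = -r ^ 2`, for `F = H(x) M` and `G = H'(x) N` it is a polynomial in
`-r ^ 2` times `[conj(M) N]_0` or `[conj(M) x N]_0`, and the inner product splits into a radial and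
a spherical factor (`qInner_eq_radial_mul`).

For the spherical factor, Stokes' formula for the Dirac operator gives `∫ [conj(M) x N]_0 = 0` and,
for different degrees, `∫ [conj(M) N]_0 = 0`. It is proved with a Gaussian weight on the whole
space, where it is integration by parts in one variable; in polar coordinates, the Gaussian and the
spherical integral of a homogeneous polynomial are proportional (`exists_gaussInt_eq`).

For the radial factor, the weight `e_Q(-r ^ 2)` at the Jackson nodes satisfies a first-order
`q`-difference equation and vanishes at `r = λ_Q`. With the `q`-binomial theorem this gives the
total mass as a `q`-Gamma value (`radial_one_eq_qGamma`), and a two-term recursion for the moments.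
The latter yields a partial `q`-integration (`IsQLaguerre.radial_mul`): up to the eigenvalue, the
product of two `q`-Laguerre polynomials integrates to that of their `q`-derivatives, which are
`q`-Laguerre polynomials of degree one less with parameter `β + 1`. Induction on the degree gives
orthogonality and norms (`radial_mul_eq`).
-/

namespace QClifford
noncomputable section

/-! ### The Clifford algebra relations on Clifford-valued polynomials -/

lemma gen_mul_gen_add_swap (m : ℕ) (i j : Fin m) :
    gen m i * gen m j + gen m j * gen m i = if i = j then (-2 : ℝ) • 1 else 0 := by
  have h : QuadraticMap.polar (negForm m) (Pi.single i 1) (Pi.single j 1)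
      = if i = j then -2 else 0 := by
    simp only [QuadraticMap.polar, negForm, QuadraticMap.weightedSumSquares_apply,
      ← Finset.sum_sub_distrib, Pi.add_apply]
    calc _ = ∑ x, (-2) * ((Pi.single i 1 : Fin m → ℝ) x * (Pi.single j 1 : Fin m → ℝ) x) := by
          refine Finset.sum_congr rfl fun x _ => ?_
          simp only [smul_eq_mul]; ring
      _ = _ := by
          rw [← Finset.mul_sum]
          simp [Pi.single_apply, eq_comm]
  rw [gen, gen, CliffordAlgebra.ι_mul_ι_add_swap, h, Algebra.algebraMap_eq_smul_one]
  split_ifs <;> simp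

/-- The generator `e_j`, as a constant Clifford-valued polynomial. -/
def cgen (m : ℕ) (j : Fin m) : CPoly m := (1 : MvPolynomial (Fin m) ℝ) ⊗ₜ[ℝ] gen m j

/-- A form of `neg_mul` for `rw`: the negation that instance search finds on `CPoly m` agrees with
that of the ring structure only after unfolding. The same holds for the next two lemmas. -/
lemma cpoly_neg_mul {m : ℕ} (F G : CPoly m) : -F * G = -(F * G) := neg_mul F G

lemma cpoly_mul_neg {m : ℕ} (F G : CPoly m) : F * -G = -(F * G) := mul_neg F G

lemma cpoly_neg_smul {m : ℕ} (c : ℝ) (F : CPoly m) : -c • F = -(c • F) := neg_smul c F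

lemma cgen_mul_cgen_add_swap (m : ℕ) (i j : Fin m) :
    cgen m i * cgen m j + cgen m j * cgen m i = if i = j then (-2 : ℝ) • (1 : CPoly m) else 0 := by
  simp only [cgen, Algebra.TensorProduct.tmul_mul_tmul, ← TensorProduct.tmul_add,
    gen_mul_gen_add_swap, mul_one]
  split_ifs
  · rw [TensorProduct.tmul_smul, Algebra.TensorProduct.one_def]
  · simp

lemma smul_eq_tmul_one_mul {m : ℕ} (P : MvPolynomial (Fin m) ℝ) (F : CPoly m) :
    P • F = (P ⊗ₜ[ℝ] (1 : Cl m)) * F := by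
  induction F using TensorProduct.induction_on with
  | zero => simp
  | add F₁ F₂ h₁ h₂ => simp only [mul_add, smul_add, h₁, h₂]
  | tmul R b => simp [TensorProduct.smul_tmul']

lemma vecVar_eq_sum (m : ℕ) :
    vecVar m = ∑ j, (MvPolynomial.X j : MvPolynomial (Fin m) ℝ) • cgen m j := by
  simp [vecVar, cgen, TensorProduct.smul_tmul']

lemma dirac_apply (m : ℕ) (F : CPoly m) :
    dirac m F = -∑ j, cgen m j * partialD m j F := by
  simp [dirac, cgen]

lemma euler_apply (m : ℕ) (F : CPoly m) :
    euler m F = ∑ j, (MvPolynomial.X j : MvPolynomial (Fin m) ℝ) • partialD m j F := by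
  simp [euler, smul_eq_tmul_one_mul]

lemma partialD_mul (m : ℕ) (j : Fin m) (F G : CPoly m) :
    partialD m j (F * G) = partialD m j F * G + F * partialD m j G := by
  induction F using TensorProduct.induction_on with
  | zero => simp
  | add F₁ F₂ h₁ h₂ => simp only [add_mul, map_add, h₁, h₂]; abel
  | tmul P a =>
    induction G using TensorProduct.induction_on with
    | zero => simp
    | add G₁ G₂ h₁ h₂ => simp only [mul_add, map_add, h₁, h₂]; abel
    | tmul R b =>
      simp [partialD, TensorProduct.add_tmul, add_comm, mul_comm]

lemma partialD_vecVar (m : ℕ) (j : Fin m) : partialD m j (vecVar m) = cgen m j := by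
  have h : ∀ i, (Pi.single j (1 : MvPolynomial (Fin m) ℝ) : Fin m → _) i ⊗ₜ[ℝ] gen m i
      = if i = j then cgen m j else 0 := by
    intro i
    by_cases hij : i = j
    · subst hij; simp [cgen]
    · simp [hij]
  simp [partialD, vecVar, MvPolynomial.pderiv_X, h]

lemma euler_mul (m : ℕ) (F G : CPoly m) :
    euler m (F * G) = euler m F * G + F * euler m G := by
  simp only [euler_apply, partialD_mul, smul_add, Finset.sum_add_distrib, Finset.sum_mul,
    Finset.mul_sum, smul_mul_assoc, mul_smul_comm]

lemma euler_vecVar (m : ℕ) : euler m (vecVar m) = vecVar m := by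
  simp only [euler_apply, partialD_vecVar]
  exact (vecVar_eq_sum m).symm

lemma cgen_mul_vecVar_add_swap (m : ℕ) (j : Fin m) :
    cgen m j * vecVar m + vecVar m * cgen m j
      = (-2 : ℝ) • ((MvPolynomial.X j : MvPolynomial (Fin m) ℝ) • (1 : CPoly m)) := by
  rw [vecVar_eq_sum, Finset.mul_sum, Finset.sum_mul, ← Finset.sum_add_distrib]
  simp only [mul_smul_comm, smul_mul_assoc, ← smul_add, cgen_mul_cgen_add_swap]
  simp only [smul_ite, smul_zero, Finset.sum_ite_eq, Finset.mem_univ, if_true]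
  rw [smul_comm]

/-- The squared norm `r ^ 2 = ∑ x_j ^ 2` as a polynomial. -/
def rSq (m : ℕ) : MvPolynomial (Fin m) ℝ := ∑ j, MvPolynomial.X j ^ 2

lemma vecVar_mul_vecVar (m : ℕ) : vecVar m * vecVar m = -(rSq m • (1 : CPoly m)) := by
  have h : (2 : ℝ) • (vecVar m * vecVar m) = (2 : ℝ) • -(rSq m • (1 : CPoly m)) := by
    have h1 : vecVar m * vecVar m
        = ∑ j, (MvPolynomial.X j : MvPolynomial (Fin m) ℝ) • (cgen m j * vecVar m) := by
      conv_lhs => enter [1]; rw [vecVar_eq_sum]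
      rw [Finset.sum_mul]
      simp only [smul_mul_assoc]
    have h2 : vecVar m * vecVar m
        = ∑ j, (MvPolynomial.X j : MvPolynomial (Fin m) ℝ) • (vecVar m * cgen m j) := by
      conv_lhs => enter [2]; rw [vecVar_eq_sum]
      rw [Finset.mul_sum]
      simp only [mul_smul_comm]
    rw [two_smul]
    nth_rw 1 [h1]
    rw [h2, ← Finset.sum_add_distrib]
    simp only [← smul_add, cgen_mul_vecVar_add_swap, rSq, Finset.sum_smul, smul_neg,
      Finset.smul_sum, ← Finset.sum_neg_distrib, cpoly_neg_smul]
    refine Finset.sum_congr rfl fun j _ => ?_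
    rw [smul_comm, smul_smul, sq]
  exact smul_right_injective _ (two_ne_zero) h

lemma vecVar_mul_vecVar_mul {m : ℕ} (F : CPoly m) :
    vecVar m * (vecVar m * F) = -(rSq m • F) := by
  rw [← mul_assoc, vecVar_mul_vecVar, cpoly_neg_mul, smul_mul_assoc, one_mul]

lemma rSq_ne_zero {m : ℕ} (hm : 1 ≤ m) : rSq m ≠ 0 := by
  intro h
  have := congrArg (MvPolynomial.eval fun _ => (1 : ℝ)) h
  simp [rSq] at this
  omega

lemma vecVar_mul_injective {m : ℕ} (hm : 1 ≤ m) :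
    Function.Injective fun g : CPoly m => vecVar m * g := by
  intro a b h
  have h' : vecVar m * (vecVar m * a) = vecVar m * (vecVar m * b) := congrArg (vecVar m * ·) h
  rw [vecVar_mul_vecVar_mul, vecVar_mul_vecVar_mul, neg_inj] at h'
  exact smul_right_injective _ (rSq_ne_zero hm) h'

/-- The anticommutation relation `∂ x + x ∂ = 2 𝔼 + m`. -/
lemma dirac_vecVar_mul (m : ℕ) (F : CPoly m) :
    dirac m (vecVar m * F) + vecVar m * dirac m F = (2 : ℝ) • euler m F + (m : ℝ) • F := by
  have hsq : ∀ j, cgen m j * cgen m j = -(1 : CPoly m) := by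
    intro j
    have h := cgen_mul_cgen_add_swap m j j
    rw [if_pos rfl, ← two_smul ℝ, cpoly_neg_smul] at h
    exact smul_right_injective _ (two_ne_zero (α := ℝ))
      (h.trans (smul_neg (2 : ℝ) (1 : CPoly m)).symm)
  have key : ∀ j, cgen m j * partialD m j (vecVar m * F) + vecVar m * (cgen m j * partialD m j F)
      = -F - (2 : ℝ) • ((MvPolynomial.X j : MvPolynomial (Fin m) ℝ) • partialD m j F) := by
    intro j
    rw [partialD_mul, partialD_vecVar, mul_add, ← mul_assoc, hsq, ← mul_assoc, ← mul_assoc,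
      add_assoc, ← add_mul, cgen_mul_vecVar_add_swap, cpoly_neg_mul, one_mul, cpoly_neg_smul,
      cpoly_neg_mul, smul_mul_assoc, smul_mul_assoc, one_mul, sub_eq_add_neg]
  rw [dirac_apply, dirac_apply, cpoly_mul_neg, ← neg_add, Finset.mul_sum, ← Finset.sum_add_distrib,
    Finset.sum_congr rfl fun j _ => key j, Finset.sum_sub_distrib, ← Finset.smul_sum,
    ← euler_apply]
  simp [Nat.cast_smul_eq_nsmul]

/-! ### Homogeneous Clifford-valued polynomials -/

/-- The space of homogeneous Clifford-valued polynomials of degree `d`. -/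
def cHomog (m d : ℕ) : Submodule ℝ (CPoly m) :=
  Submodule.span ℝ {F | ∃ (P : MvPolynomial (Fin m) ℝ) (a : Cl m), P.IsHomogeneous d ∧
    F = P ⊗ₜ[ℝ] a}

lemma tmul_mem_cHomog {m d : ℕ} {P : MvPolynomial (Fin m) ℝ} (hP : P.IsHomogeneous d) (a : Cl m) :
    P ⊗ₜ[ℝ] a ∈ cHomog m d := Submodule.subset_span ⟨P, a, hP, rfl⟩

lemma weight_one_eq_degree {m : ℕ} (s : Fin m →₀ ℕ) :
    Finsupp.weight (1 : Fin m → ℕ) s = s.degree := by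
  rw [Finsupp.degree_eq_weight_one]; rfl

/-- The converse of Euler's identity for homogeneous polynomials. -/
lemma isHomogeneous_of_euler {m k : ℕ} {P : MvPolynomial (Fin m) ℝ}
    (h : ∑ j, MvPolynomial.X j * MvPolynomial.pderiv j P = (k : ℝ) • P) :
    P.IsHomogeneous k := by
  have key : ∀ R : MvPolynomial (Fin m) ℝ, ∀ s : Fin m →₀ ℕ,
      (∑ j, MvPolynomial.X j * MvPolynomial.pderiv j R).coeff s = (s.degree : ℝ) * R.coeff s := by
    intro R s
    induction R using MvPolynomial.induction_on' with
    | monomial u a =>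
      rw [(MvPolynomial.isHomogeneous_monomial a rfl).sum_X_mul_pderiv, nsmul_eq_mul,
        ← map_natCast (MvPolynomial.C), MvPolynomial.coeff_C_mul, MvPolynomial.coeff_monomial]
      split_ifs with hu
      · rw [hu]
      · simp
    | add p r hp hr =>
      simp only [map_add, mul_add, Finset.sum_add_distrib, MvPolynomial.coeff_add, hp, hr]
  intro s hs
  have h2 := key P s
  rw [h, MvPolynomial.coeff_smul, smul_eq_mul] at h2
  have h3 := mul_right_cancel₀ hs h2
  rw [weight_one_eq_degree]
  exact_mod_cast h3.symm

lemma mem_cHomog_of_euler {m k : ℕ} {F : CPoly m} (h : euler m F = (k : ℝ) • F) :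
    F ∈ cHomog m k := by
  classical
  let b := Module.Free.chooseBasis ℝ (Cl m)
  let e := TensorProduct.equivFinsuppOfBasisRight (M := MvPolynomial (Fin m) ℝ) b
  have he : ∀ (G : CPoly m) i,
      e (euler m G) i = ∑ j, MvPolynomial.X j * MvPolynomial.pderiv j (e G i) := by
    intro G i
    induction G using TensorProduct.induction_on with
    | zero => simp
    | add G₁ G₂ h₁ h₂ =>
      simp only [map_add, Finsupp.add_apply, h₁, h₂, mul_add, Finset.sum_add_distrib]
    | tmul R a =>
      simp [e, euler_apply, partialD, TensorProduct.smul_tmul']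
  have h2 : ∀ i, (e F i).IsHomogeneous k := by
    intro i
    apply isHomogeneous_of_euler
    rw [← he, h, map_smul, Finsupp.smul_apply]
  rw [← e.symm_apply_apply F, TensorProduct.equivFinsuppOfBasisRight_symm_apply]
  exact Submodule.sum_mem _ fun i _ => tmul_mem_cHomog (h2 i) _

lemma dilate_of_mem_cHomog {m d : ℕ} {F : CPoly m} (hF : F ∈ cHomog m d) (c : ℝ) :
    dilate m c F = c ^ d • F := by
  induction hF using Submodule.span_induction with
  | zero => simp
  | add F G _ _ h₁ h₂ => rw [map_add, h₁, h₂, smul_add]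
  | smul r F _ h => rw [map_smul, h, smul_comm]
  | mem F hF =>
    obtain ⟨P, a, hP, rfl⟩ := hF
    have : MvPolynomial.aeval (fun i => MvPolynomial.C c * MvPolynomial.X i) P = c ^ d • P := by
      rw [← P.support_sum_monomial_coeff, map_sum, Finset.smul_sum]
      refine Finset.sum_congr rfl fun s hs => ?_
      have hd := hP (MvPolynomial.mem_support_iff.mp hs)
      rw [weight_one_eq_degree] at hd
      rw [MvPolynomial.aeval_monomial, MvPolynomial.monomial_eq, ← hd, Finsupp.degree_apply]
      simp [Finsupp.prod, mul_pow, Finset.prod_mul_distrib, Finset.prod_pow_eq_pow_sum,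
        MvPolynomial.smul_eq_C_mul]
      ring
    rw [dilate, Algebra.TensorProduct.map_tmul, this, AlgHom.id_apply, TensorProduct.smul_tmul']

/-! ### The Clifford-valued pairing -/

/-- The scalar part as a linear map. -/
def scalarPartₗ (m : ℕ) : Cl m →ₗ[ℝ] ℝ :=
  ExteriorAlgebra.algebraMapInv.toLinearMap ∘ₗ
    (CliffordAlgebra.equivExterior (negForm m)).toLinearMap

lemma scalarPartₗ_apply (m : ℕ) (a : Cl m) : scalarPartₗ m a = scalarPart m a := rfl

/-- The conjugation of the Clifford algebra as a linear map. -/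
def conjₗ (m : ℕ) : Cl m →ₗ[ℝ] Cl m :=
  CliffordAlgebra.reverse ∘ₗ (CliffordAlgebra.involute (Q := negForm m)).toLinearMap

lemma conjₗ_apply (m : ℕ) (a : Cl m) : conjₗ m a = star a := rfl

/-- The pairing `(F, G) ↦ [conj(F) G]_0` with values in the real polynomials. -/
def pairing (m : ℕ) : CPoly m →ₗ[ℝ] CPoly m →ₗ[ℝ] MvPolynomial (Fin m) ℝ :=
  (LinearMap.mul ℝ (CPoly m)).compr₂
    ((TensorProduct.rid ℝ (MvPolynomial (Fin m) ℝ)).toLinearMap ∘ₗ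
      TensorProduct.map LinearMap.id (scalarPartₗ m)) ∘ₗ
    TensorProduct.map LinearMap.id (conjₗ m)

lemma pairing_tmul (m : ℕ) (P R : MvPolynomial (Fin m) ℝ) (a b : Cl m) :
    pairing m (P ⊗ₜ a) (R ⊗ₜ b) = scalarPart m (star a * b) • (P * R) := by
  simp [pairing, conjₗ_apply, scalarPartₗ_apply]

/-- Two biadditive statements on Clifford-valued polynomials agree once they agree on pure
tensors. -/
lemma cpoly_induction₂ {m : ℕ} {p : CPoly m → CPoly m → Prop}
    (h0l : ∀ G, p 0 G) (h0r : ∀ F, p F 0)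
    (hl : ∀ F₁ F₂ G, p F₁ G → p F₂ G → p (F₁ + F₂) G)
    (hr : ∀ F G₁ G₂, p F G₁ → p F G₂ → p F (G₁ + G₂))
    (ht : ∀ P a R b, p (P ⊗ₜ a) (R ⊗ₜ b)) (F G : CPoly m) : p F G := by
  induction F using TensorProduct.induction_on with
  | zero => exact h0l G
  | add F₁ F₂ h₁ h₂ => exact hl _ _ _ h₁ h₂
  | tmul P a =>
    induction G using TensorProduct.induction_on with
    | zero => exact h0r _
    | add G₁ G₂ h₁ h₂ => exact hr _ _ _ h₁ h₂
    | tmul R b => exact ht P a R b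

lemma eval_pairing (m : ℕ) (y : EuclideanSpace ℝ (Fin m)) (F G : CPoly m) :
    MvPolynomial.eval (fun i => y i) (pairing m F G)
      = scalarPart m (star (evalAt m y F) * evalAt m y G) := by
  rw [← scalarPartₗ_apply, ← conjₗ_apply]
  induction F, G using cpoly_induction₂ with
  | h0l G => simp
  | h0r F => simp
  | hl F₁ F₂ G h₁ h₂ => simp [add_mul, h₁, h₂]
  | hr F G₁ G₂ h₁ h₂ => simp [mul_add, h₁, h₂]
  | ht P a R b =>
    rw [pairing_tmul]
    simp [evalAt, conjₗ_apply, scalarPartₗ_apply, MvPolynomial.smul_eval,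
      MvPolynomial.aeval_eq_eval]
    ring

lemma pairing_smul_left (m : ℕ) (P : MvPolynomial (Fin m) ℝ) (F G : CPoly m) :
    pairing m (P • F) G = P * pairing m F G := by
  induction F, G using cpoly_induction₂ with
  | h0l G => simp
  | h0r F => simp
  | hl F₁ F₂ G h₁ h₂ => simp only [smul_add, map_add, LinearMap.add_apply, mul_add, h₁, h₂]
  | hr F G₁ G₂ h₁ h₂ => simp only [map_add, mul_add, h₁, h₂]
  | ht P a R b => simp [pairing_tmul, TensorProduct.smul_tmul', mul_assoc]

lemma pairing_smul_right (m : ℕ) (P : MvPolynomial (Fin m) ℝ) (F G : CPoly m) :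
    pairing m F (P • G) = P * pairing m F G := by
  induction F, G using cpoly_induction₂ with
  | h0l G => simp
  | h0r F => simp
  | hl F₁ F₂ G h₁ h₂ => simp only [map_add, LinearMap.add_apply, mul_add, h₁, h₂]
  | hr F G₁ G₂ h₁ h₂ => simp only [smul_add, map_add, mul_add, h₁, h₂]
  | ht P a R b => simp [pairing_tmul, TensorProduct.smul_tmul', mul_left_comm]

lemma pairing_cgen_mul (m : ℕ) (j : Fin m) (F G : CPoly m) :
    pairing m (cgen m j * F) G = -pairing m F (cgen m j * G) := by
  induction F, G using cpoly_induction₂ with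
  | h0l G => simp
  | h0r F => simp
  | hl F₁ F₂ G h₁ h₂ => simp only [mul_add, map_add, LinearMap.add_apply, h₁, h₂, neg_add]
  | hr F G₁ G₂ h₁ h₂ => simp only [mul_add, map_add, h₁, h₂, neg_add]
  | ht P a R b =>
    have h : scalarPart m (star a * star (gen m j) * b)
        = -scalarPart m (star a * (gen m j * b)) := by
      rw [gen, CliffordAlgebra.star_ι, mul_neg, neg_mul, mul_assoc]
      exact map_neg (scalarPartₗ m) _
    simp [pairing_tmul, cgen, h]

lemma pairing_vecVar_mul (m : ℕ) (F G : CPoly m) :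
    pairing m (vecVar m * F) G = -pairing m F (vecVar m * G) := by
  simp only [vecVar_eq_sum, Finset.sum_mul, smul_mul_assoc, map_sum, LinearMap.sum_apply,
    pairing_smul_left, pairing_smul_right, pairing_cgen_mul, mul_neg, Finset.sum_neg_distrib]

lemma pderiv_pairing (m : ℕ) (j : Fin m) (F G : CPoly m) :
    MvPolynomial.pderiv j (pairing m F G)
      = pairing m (partialD m j F) G + pairing m F (partialD m j G) := by
  induction F, G using cpoly_induction₂ with
  | h0l G => simp
  | h0r F => simp
  | hl F₁ F₂ G h₁ h₂ => simp only [map_add, LinearMap.add_apply, h₁, h₂]; abel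
  | hr F G₁ G₂ h₁ h₂ => simp only [map_add, h₁, h₂]; abel
  | ht P a R b => simp [pairing_tmul, partialD, ← smul_add, add_comm, mul_comm]

lemma isHomogeneous_pairing {m k l : ℕ} {F G : CPoly m} (hF : F ∈ cHomog m k)
    (hG : G ∈ cHomog m l) : (pairing m F G).IsHomogeneous (k + l) := by
  rw [← MvPolynomial.mem_homogeneousSubmodule]
  induction hF using Submodule.span_induction with
  | zero => simp
  | add F₁ F₂ _ _ h₁ h₂ => simpa using add_mem h₁ h₂
  | smul r F _ h => simpa using Submodule.smul_mem _ r h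
  | mem F hF =>
    obtain ⟨P, a, hP, rfl⟩ := hF
    induction hG using Submodule.span_induction with
    | zero => simp
    | add G₁ G₂ _ _ h₁ h₂ => simpa using add_mem h₁ h₂
    | smul r G _ h => simpa using Submodule.smul_mem _ r h
    | mem G hG =>
      obtain ⟨R, b, hR, rfl⟩ := hG
      rw [pairing_tmul]
      exact Submodule.smul_mem _ _ (hP.mul hR)

/-- The divergence of the vector field `B(F, e_j G)`: the pointwise form of Stokes' formula for
the Dirac operator. -/
lemma sum_pderiv_pairing_cgen_mul (m : ℕ) (F G : CPoly m) :
    ∑ j, MvPolynomial.pderiv j (pairing m F (cgen m j * G))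
      = pairing m (dirac m F) G - pairing m F (dirac m G) := by
  have h : ∀ j, partialD m j (cgen m j) = 0 := fun j => by simp [partialD, cgen]
  simp only [pderiv_pairing, partialD_mul, h, zero_mul, zero_add, dirac_apply, map_neg,
    LinearMap.neg_apply, map_sum, LinearMap.sum_apply, pairing_cgen_mul, Finset.sum_neg_distrib,
    neg_neg, sub_neg_eq_add, Finset.sum_add_distrib]

lemma sum_X_mul_pairing_cgen_mul (m : ℕ) (F G : CPoly m) :
    ∑ j, MvPolynomial.X j * pairing m F (cgen m j * G) = pairing m F (vecVar m * G) := by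
  simp only [vecVar_eq_sum, Finset.sum_mul, smul_mul_assoc, map_sum, pairing_smul_right]


/-! ### The `q`-exponential at the Jackson nodes -/

lemma qNum_add {q : ℝ} (hq : 0 < q) (u v : ℝ) : qNum q (u + v) = qNum q u + q ^ u * qNum q v := by
  simp only [qNum, Real.rpow_add hq]; ring

lemma qNum_zero (q : ℝ) : qNum q 0 = 0 := by simp [qNum]

lemma qNum_pos {q u : ℝ} (hq0 : 0 < q) (hq1 : q < 1) (hu : 0 < u) : 0 < qNum q u :=
  div_pos_of_neg_of_neg (sub_neg.mpr (Real.rpow_lt_one hq0.le hq1 hu)) (sub_neg.mpr hq1)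

lemma qFactorial_succ (q : ℝ) (n : ℕ) :
    qFactorial q (n + 1) = qFactorial q n * qNum q ((n : ℝ) + 1) := by
  simp [qFactorial, Finset.prod_range_succ]

lemma qFactorial_pos {q : ℝ} (hq0 : 0 < q) (hq1 : q < 1) (n : ℕ) : 0 < qFactorial q n :=
  Finset.prod_pos fun i _ => qNum_pos hq0 hq1 (by positivity)

lemma qExp_term_succ {q : ℝ} (hq0 : 0 < q) (hq1 : q < 1) (t : ℝ) (j : ℕ) :
    q ^ ((j + 1) * (j + 1 - 1) / 2) * t ^ (j + 1) / qFactorial q (j + 1)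
      = q ^ j * t / qNum q ((j : ℝ) + 1)
        * (q ^ (j * (j - 1) / 2) * t ^ j / qFactorial q j) := by
  have h : (j + 1) * (j + 1 - 1) / 2 = j * (j - 1) / 2 + j := by
    rw [← Finset.sum_range_id, ← Finset.sum_range_id, Finset.sum_range_succ]
  have h1 := (qFactorial_pos hq0 hq1 j).ne'
  have h2 := (qNum_pos hq0 hq1 (u := (j : ℝ) + 1) (by positivity)).ne'
  rw [h, qFactorial_succ, pow_add, pow_succ]
  field_simp

lemma one_le_qNum_succ {q : ℝ} (hq0 : 0 < q) (hq1 : q < 1) (j : ℕ) :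
    1 ≤ qNum q ((j : ℝ) + 1) := by
  rw [add_comm, qNum_add hq0, Real.rpow_one]
  have h : qNum q 1 = 1 := by
    rw [qNum, Real.rpow_one, div_self (by linarith)]
  have h2 : 0 ≤ qNum q j := by
    rcases Nat.eq_zero_or_pos j with rfl | hj
    · simp [qNum_zero]
    · exact (qNum_pos hq0 hq1 (by exact_mod_cast hj)).le
  rw [h]
  nlinarith

lemma summable_qExp {q : ℝ} (hq0 : 0 < q) (hq1 : q < 1) (t : ℝ) :
    Summable fun j : ℕ => q ^ (j * (j - 1) / 2) * t ^ j / qFactorial q j := by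
  refine summable_of_ratio_norm_eventually_le (r := 1 / 2) (by norm_num) ?_
  have h : Filter.Tendsto (fun j : ℕ => q ^ j * |t|) Filter.atTop (nhds 0) := by
    simpa using (tendsto_pow_atTop_nhds_zero_of_lt_one hq0.le hq1).mul_const |t|
  filter_upwards [h.eventually (gt_mem_nhds (show (0 : ℝ) < 1 / 2 by norm_num))] with j hj
  rw [qExp_term_succ hq0 hq1, norm_mul]
  refine mul_le_mul_of_nonneg_right ?_ (norm_nonneg _)
  have h1 := one_le_qNum_succ hq0 hq1 j
  rw [norm_div, norm_mul, Real.norm_eq_abs, Real.norm_eq_abs, Real.norm_eq_abs, abs_of_pos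
    (pow_pos hq0 j), abs_of_pos (zero_lt_one.trans_le h1)]
  exact (div_le_self (by positivity) h1).trans hj.le

/-- The `q`-difference equation of the `q`-exponential. -/
lemma qExp_eq {q : ℝ} (hq0 : 0 < q) (hq1 : q < 1) (t : ℝ) :
    qExp q t = (1 + (1 - q) * t) * qExp q (q * t) := by
  have h1 := summable_qExp hq0 hq1 t
  have h2 := summable_qExp hq0 hq1 (q * t)
  have h : qExp q t - qExp q (q * t) = (1 - q) * t * qExp q (q * t) := by
    rw [qExp, qExp, ← h1.tsum_sub h2, (h1.sub h2).tsum_eq_zero_add, ← tsum_mul_left]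
    simp only [pow_zero, sub_self, zero_add]
    refine tsum_congr fun j => ?_
    rw [qExp_term_succ hq0 hq1, qExp_term_succ hq0 hq1]
    have h3 := (qNum_pos hq0 hq1 (u := (j : ℝ) + 1) (by positivity)).ne'
    have h4 : 1 - q ^ (j + 1) = qNum q ((j : ℝ) + 1) * (1 - q) := by
      have h5 : q - 1 ≠ 0 := by linarith
      rw [qNum, ← Nat.cast_add_one, Real.rpow_natCast]
      field_simp
      ring
    have h6 := (qFactorial_pos hq0 hq1 j).ne'
    calc _ = (q ^ j * t / qNum q ((j : ℝ) + 1))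
          * (q ^ (j * (j - 1) / 2) * t ^ j / qFactorial q j) * (1 - q ^ (j + 1)) := by
            rw [mul_pow]; ring
      _ = _ := by
            rw [h4, mul_pow]; field_simp
  linarith

lemma tendsto_qExp_nhds_zero {q : ℝ} (hq0 : 0 < q) (hq1 : q < 1) :
    Filter.Tendsto (qExp q) (nhds 0) (nhds 1) := by
  have h0 : qExp q 0 = 1 := by
    rw [qExp, tsum_eq_single 0]
    · simp [qFactorial]
    · intro j hj; simp [hj]
  have hc : ContinuousOn (qExp q) (Set.Icc (-1) 1) := by
    refine continuousOn_tsum (fun j => by fun_prop) (summable_qExp hq0 hq1 1) ?_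
    intro j t ht
    have := (qFactorial_pos hq0 hq1 j)
    rw [norm_div, norm_mul, Real.norm_eq_abs, Real.norm_eq_abs, Real.norm_eq_abs, abs_of_pos this,
      abs_of_pos (pow_pos hq0 _), abs_pow, one_pow]
    gcongr
    exact pow_le_one₀ (abs_nonneg t) (abs_le.mpr ht)
  have h := hc.continuousAt (Icc_mem_nhds (show (-1 : ℝ) < 0 by norm_num) one_pos)
  rw [ContinuousAt, h0] at h
  exact h

section Radial

variable {q : ℝ}

lemma sq_lt_one (hq0 : 0 < q) (hq1 : q < 1) : q ^ 2 < 1 := pow_lt_one₀ hq0.le hq1 two_ne_zero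

lemma lamQ_sq (hq0 : 0 < q) (hq1 : q < 1) : lamQ q ^ 2 = 1 / (1 - q ^ 2) :=
  Real.sq_sqrt (one_div_nonneg.mpr (sub_nonneg.mpr (sq_lt_one hq0 hq1).le))

/-- The value of the weight `e_Q(-r ^ 2)` at the node `r = λ_Q q ^ n`. -/
def nodeExp (q : ℝ) (n : ℕ) : ℝ := qExp (q ^ 2) (-(lamQ q * q ^ n) ^ 2)

lemma nodeExp_eq (hq0 : 0 < q) (hq1 : q < 1) (n : ℕ) :
    nodeExp q n = (1 - (q ^ 2) ^ n) * nodeExp q (n + 1) := by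
  have h1 : 1 - q ^ 2 ≠ 0 := (sub_pos.mpr (sq_lt_one hq0 hq1)).ne'
  rw [nodeExp, nodeExp, qExp_eq (pow_pos hq0 2) (sq_lt_one hq0 hq1)]
  congr 1
  · rw [mul_pow, lamQ_sq hq0 hq1]
    field_simp
    ring
  · congr 1; ring

lemma tendsto_nodeExp (hq0 : 0 < q) (hq1 : q < 1) :
    Filter.Tendsto (nodeExp q) Filter.atTop (nhds 1) := by
  refine (tendsto_qExp_nhds_zero (pow_pos hq0 2) (sq_lt_one hq0 hq1)).comp ?_
  have h := (((tendsto_pow_atTop_nhds_zero_of_lt_one hq0.le hq1).const_mul (lamQ q)).pow 2).neg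
  simpa using h

lemma exists_nodeExp_bound (hq0 : 0 < q) (hq1 : q < 1) : ∃ C, 0 ≤ C ∧ ∀ n, |nodeExp q n| ≤ C := by
  obtain ⟨C, hC⟩ := (Metric.isBounded_range_of_tendsto _ (tendsto_nodeExp hq0 hq1)).exists_norm_le
  exact ⟨C, (norm_nonneg _).trans (hC _ ⟨0, rfl⟩), fun n => hC _ ⟨n, rfl⟩⟩

lemma multipliable_one_sub (hq0 : 0 < q) (hq1 : q < 1) (z : ℝ) :
    Multipliable fun k : ℕ => 1 - z * q ^ k := by
  simp only [sub_eq_add_neg]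
  exact Real.multipliable_one_add_of_summable
    (((summable_geometric_of_lt_one hq0.le hq1).mul_left z).neg)

/-- The weight at the first interior node is the Euler product `(Q; Q)_∞`. -/
lemma nodeExp_one (hq0 : 0 < q) (hq1 : q < 1) :
    nodeExp q 1 = ∏' k : ℕ, (1 - (q ^ 2) ^ (k + 1)) := by
  have h : ∀ n, nodeExp q 1
      = (∏ k ∈ Finset.range n, (1 - (q ^ 2) ^ (k + 1))) * nodeExp q (n + 1) := by
    intro n
    induction n with
    | zero => simp
    | succ n ih => rw [ih, Finset.prod_range_succ, nodeExp_eq hq0 hq1 (n + 1), mul_assoc]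
  have hm := multipliable_one_sub (pow_pos hq0 2) (sq_lt_one hq0 hq1) (q ^ 2)
  simp only [← pow_succ'] at hm
  have h2 := hm.hasProd.tendsto_prod_nat.mul
    ((Filter.tendsto_add_atTop_iff_nat 1).mpr (tendsto_nodeExp hq0 hq1))
  rw [mul_one] at h2
  exact tendsto_nhds_unique (tendsto_const_nhds.congr h) h2

lemma nodeExp_one_ne_zero (hq0 : 0 < q) (hq1 : q < 1) : nodeExp q 1 ≠ 0 := by
  intro h
  have h2 : ∀ n, nodeExp q (n + 1) = 0 := by
    intro n
    induction n with
    | zero => exact h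
    | succ n ih =>
      rw [nodeExp_eq hq0 hq1, mul_eq_zero] at ih
      refine ih.resolve_left (sub_pos.mpr ?_).ne'
      exact pow_lt_one₀ (by positivity) (sq_lt_one hq0 hq1) (Nat.succ_ne_zero n)
  have h3 := (Filter.tendsto_add_atTop_iff_nat 1).mpr (tendsto_nodeExp hq0 hq1)
  simp only [h2] at h3
  exact zero_ne_one (tendsto_nhds_unique tendsto_const_nhds h3)

/-- The generating function `∑_n z ^ n e_Q(-λ_Q ^ 2 Q ^ (n + 1))` of the node weights. -/
def nodeSeries (q z : ℝ) : ℝ := ∑' n : ℕ, z ^ n * nodeExp q (n + 1)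

lemma summable_nodeSeries (hq0 : 0 < q) (hq1 : q < 1) {z : ℝ} (hz : |z| < 1) (i : ℕ) :
    Summable fun n : ℕ => z ^ n * nodeExp q (n + i) := by
  obtain ⟨C, _, hC⟩ := exists_nodeExp_bound hq0 hq1
  refine Summable.of_norm_bounded
    (g := fun n => |z| ^ n * C) ((summable_geometric_of_lt_one (abs_nonneg z) hz).mul_right C) ?_
  intro n
  rw [norm_mul, norm_pow, Real.norm_eq_abs, Real.norm_eq_abs]
  gcongr
  exact hC _

lemma tsum_pow_mul_nodeExp (hq0 : 0 < q) (hq1 : q < 1) {z : ℝ} (hz : |z| < 1) :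
    ∑' n : ℕ, z ^ n * nodeExp q n = z * nodeSeries q z := by
  -- The weight vanishes at the outermost node `r = λ_Q`.
  have h0 : nodeExp q 0 = 0 := by rw [nodeExp_eq hq0 hq1]; simp
  have h1 := (summable_nodeSeries hq0 hq1 hz 0).tsum_eq_zero_add
  simp only [add_zero, h0, mul_zero, zero_add] at h1
  rw [h1, nodeSeries, ← tsum_mul_left]
  exact tsum_congr fun n => by rw [pow_succ', mul_assoc]

lemma nodeSeries_sq_mul (hq0 : 0 < q) (hq1 : q < 1) {z : ℝ} (hz : |z| < 1) :
    nodeSeries q (q ^ 2 * z) = (1 - z) * nodeSeries q z := by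
  have hz' : |q ^ 2 * z| < 1 := by
    rw [abs_mul, abs_of_pos (pow_pos hq0 2)]
    nlinarith [abs_nonneg z, sq_lt_one hq0 hq1, pow_pos hq0 2]
  have h : nodeSeries q z - nodeSeries q (q ^ 2 * z) = z * nodeSeries q z := by
    rw [← tsum_pow_mul_nodeExp hq0 hq1 hz, nodeSeries, nodeSeries,
      ← (summable_nodeSeries hq0 hq1 hz 1).tsum_sub (summable_nodeSeries hq0 hq1 hz' 1)]
    refine tsum_congr fun n => ?_
    rw [nodeExp_eq hq0 hq1 n, mul_pow]
    ring
  linarith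

/-- The `q`-binomial theorem for `nodeSeries`. -/
lemma nodeSeries_mul_tprod (hq0 : 0 < q) (hq1 : q < 1) {z : ℝ} (hz : |z| < 1) :
    (∏' k : ℕ, (1 - z * (q ^ 2) ^ k)) * nodeSeries q z = nodeExp q 1 := by
  have hQ := sq_lt_one hq0 hq1
  have hzn : ∀ n : ℕ, |(q ^ 2) ^ n * z| < 1 := by
    intro n
    rw [abs_mul, abs_of_pos (by positivity)]
    calc _ ≤ 1 * |z| := by
          gcongr
          exact pow_le_one₀ (by positivity) hQ.le
      _ < 1 := by rwa [one_mul]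
  have h : ∀ n, (∏ k ∈ Finset.range n, (1 - z * (q ^ 2) ^ k)) * nodeSeries q z
      = nodeSeries q ((q ^ 2) ^ n * z) := by
    intro n
    induction n with
    | zero => simp
    | succ n ih =>
      rw [Finset.prod_range_succ, mul_right_comm, ih, pow_succ' (q ^ 2) n, mul_assoc,
        nodeSeries_sq_mul hq0 hq1 (hzn n)]
      ring
  have hc : ContinuousOn (nodeSeries q) (Set.Icc (-|z|) |z|) := by
    obtain ⟨C, hC0, hC⟩ := exists_nodeExp_bound hq0 hq1
    refine continuousOn_tsum (u := fun n => |z| ^ n * C) (fun j => by fun_prop)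
      ((summable_geometric_of_lt_one (abs_nonneg z) hz).mul_right C) ?_
    intro n w hw
    rw [norm_mul, norm_pow, Real.norm_eq_abs, Real.norm_eq_abs]
    have := abs_le.mpr hw
    gcongr
    exact hC _
  have h0 : nodeSeries q 0 = nodeExp q 1 := by
    rw [nodeSeries, tsum_eq_single 0]
    · simp
    · intro n hn; simp [hn]
  have ht : Filter.Tendsto (fun n : ℕ => (q ^ 2) ^ n * z) Filter.atTop
      (nhdsWithin 0 (Set.Icc (-|z|) |z|)) := by
    rw [tendsto_nhdsWithin_iff]
    constructor
    · simpa using (tendsto_pow_atTop_nhds_zero_of_lt_one (pow_pos hq0 2).le hQ).mul_const z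
    · refine Filter.Eventually.of_forall fun n => ?_
      rw [Set.mem_Icc, ← abs_le, abs_mul, abs_of_pos (by positivity)]
      exact mul_le_of_le_one_left (abs_nonneg z) (pow_le_one₀ (by positivity) hQ.le)
  have h1 := (hc 0 ⟨by simp, abs_nonneg z⟩).tendsto.comp ht
  rw [h0] at h1
  have h2 := (multipliable_one_sub (pow_pos hq0 2) hQ z).hasProd.tendsto_prod_nat.mul_const
    (nodeSeries q z)
  exact tendsto_nhds_unique h2 (h1.congr fun n => (h n).symm)

/-! ### Radial moments -/

lemma summable_radial (hq0 : 0 < q) (hq1 : q < 1) (N : ℕ) (p : Polynomial ℝ) :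
    Summable fun n : ℕ => (lamQ q * q ^ n) ^ N * (p.eval (-(lamQ q * q ^ n) ^ 2)
      * qExp (q ^ 2) (-(lamQ q * q ^ n) ^ 2)) * q ^ n := by
  have h : Filter.Tendsto (fun n : ℕ => (lamQ q * q ^ n) ^ N
      * (p.eval (-(lamQ q * q ^ n) ^ 2) * nodeExp q n)) Filter.atTop
      (nhds ((lamQ q * 0) ^ N * (p.eval (-(lamQ q * 0) ^ 2) * 1))) := by
    have h1 := (tendsto_pow_atTop_nhds_zero_of_lt_one hq0.le hq1).const_mul (lamQ q)
    have h2 : Filter.Tendsto (fun n : ℕ => p.eval (-(lamQ q * q ^ n) ^ 2)) Filter.atTop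
        (nhds (p.eval (-(lamQ q * 0) ^ 2))) := (p.continuous.tendsto _).comp (h1.pow 2).neg
    exact (h1.pow N).mul (h2.mul (tendsto_nodeExp hq0 hq1))
  obtain ⟨C, hC⟩ := (Metric.isBounded_range_of_tendsto _ h).exists_norm_le
  refine Summable.of_norm_bounded (g := fun n => C * q ^ n)
    ((summable_geometric_of_lt_one hq0.le hq1).mul_left C) ?_
  intro n
  rw [norm_mul, norm_pow, Real.norm_of_nonneg hq0.le]
  exact mul_le_mul_of_nonneg_right (hC _ ⟨n, rfl⟩) (by positivity)

/-- The functional `p ↦ ∫_0^{λ_Q} r ^ N p(-r ^ 2) e_Q(-r ^ 2) d_q r` on polynomials. -/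
def radial (hq0 : 0 < q) (hq1 : q < 1) (N : ℕ) : Polynomial ℝ →ₗ[ℝ] ℝ where
  toFun p := jackson q (lamQ q) fun r => r ^ N * (p.eval (-r ^ 2) * qExp (q ^ 2) (-r ^ 2))
  map_add' p g := by
    rw [jackson, jackson, jackson, ← mul_add,
      ← (summable_radial hq0 hq1 N p).tsum_add (summable_radial hq0 hq1 N g)]
    congr 1
    refine tsum_congr fun n => ?_
    rw [Polynomial.eval_add]; ring
  map_smul' c p := by
    have h : ∀ n : ℕ, (lamQ q * q ^ n) ^ N * ((c • p).eval (-(lamQ q * q ^ n) ^ 2)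
        * qExp (q ^ 2) (-(lamQ q * q ^ n) ^ 2)) * q ^ n
        = c * ((lamQ q * q ^ n) ^ N * (p.eval (-(lamQ q * q ^ n) ^ 2)
        * qExp (q ^ 2) (-(lamQ q * q ^ n) ^ 2)) * q ^ n) := fun n => by
      rw [Polynomial.eval_smul, smul_eq_mul]; ring
    rw [jackson, tsum_congr h, tsum_mul_left, RingHom.id_apply, smul_eq_mul, jackson]
    ring

lemma radial_apply (hq0 : 0 < q) (hq1 : q < 1) (N : ℕ) (p : Polynomial ℝ) :
    radial hq0 hq1 N p
      = jackson q (lamQ q) fun r => r ^ N * (p.eval (-r ^ 2) * qExp (q ^ 2) (-r ^ 2)) := rfl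

lemma radial_X_mul (hq0 : 0 < q) (hq1 : q < 1) (N : ℕ) (p : Polynomial ℝ) :
    radial hq0 hq1 N (Polynomial.X * p) = -radial hq0 hq1 (N + 2) p := by
  rw [← map_neg, radial_apply, radial_apply]
  congr 1
  funext r
  simp only [Polynomial.eval_mul, Polynomial.eval_X, Polynomial.eval_neg]
  ring

lemma radial_one (hq0 : 0 < q) (hq1 : q < 1) (N : ℕ) :
    radial hq0 hq1 N 1
      = (1 - q) * lamQ q ^ (N + 1) * (q ^ (N + 1) * nodeSeries q (q ^ (N + 1))) := by
  have hz : |q ^ (N + 1)| < 1 := by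
    rw [abs_of_pos (pow_pos hq0 _)]
    exact pow_lt_one₀ hq0.le hq1 (Nat.succ_ne_zero N)
  rw [← tsum_pow_mul_nodeExp hq0 hq1 hz, radial_apply, jackson, pow_succ (lamQ q), ← tsum_mul_left,
    ← tsum_mul_left]
  refine tsum_congr fun n => ?_
  rw [Polynomial.eval_one, nodeExp]
  ring

lemma sq_rpow_half (hq0 : 0 < q) (N : ℕ) : (q ^ 2) ^ (((N : ℝ) + 1) / 2) = q ^ (N + 1) := by
  rw [← Real.rpow_natCast q 2, ← Real.rpow_mul hq0.le, ← Real.rpow_natCast]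
  congr 1
  push_cast
  ring

lemma radial_add_two_one (hq0 : 0 < q) (hq1 : q < 1) (N : ℕ) :
    radial hq0 hq1 (N + 2) 1 = q ^ 2 * qNum (q ^ 2) (((N : ℝ) + 1) / 2) * radial hq0 hq1 N 1 := by
  have hz : |q ^ (N + 1)| < 1 := by
    rw [abs_of_pos (pow_pos hq0 _)]
    exact pow_lt_one₀ hq0.le hq1 (Nat.succ_ne_zero N)
  have h1 : q ^ 2 - 1 ≠ 0 := (sub_neg.mpr (sq_lt_one hq0 hq1)).ne
  have h2 : 1 - q ^ 2 ≠ 0 := (sub_pos.mpr (sq_lt_one hq0 hq1)).ne'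
  rw [radial_one, radial_one, show q ^ (N + 2 + 1) = q ^ 2 * q ^ (N + 1) by ring,
    nodeSeries_sq_mul hq0 hq1 hz, qNum, sq_rpow_half hq0,
    show lamQ q ^ (N + 2 + 1) = lamQ q ^ 2 * lamQ q ^ (N + 1) by ring, lamQ_sq hq0 hq1]
  field_simp
  ring

/-- The total mass of the radial weight is a `q`-Gamma value. -/
lemma radial_one_eq_qGamma (hq0 : 0 < q) (hq1 : q < 1) (N : ℕ) :
    radial hq0 hq1 N 1 = (q ^ 2) ^ (((N : ℝ) + 1) / 2) * qGamma (q ^ 2) (((N : ℝ) + 1) / 2)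
      / (q + 1) := by
  have hz : |q ^ (N + 1)| < 1 := by
    rw [abs_of_pos (pow_pos hq0 _)]
    exact pow_lt_one₀ hq0.le hq1 (Nat.succ_ne_zero N)
  have hQ : 0 < 1 - q ^ 2 := sub_pos.mpr (sq_lt_one hq0 hq1)
  have hp := nodeSeries_mul_tprod hq0 hq1 hz
  have hP : (∏' k : ℕ, (1 - (q ^ 2) ^ (((N : ℝ) + 1) / 2 + (k : ℝ))))
      = ∏' k : ℕ, (1 - q ^ (N + 1) * (q ^ 2) ^ k) := by
    refine tprod_congr fun k => ?_
    rw [Real.rpow_add (pow_pos hq0 2), sq_rpow_half hq0, Real.rpow_natCast]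
  have hP0 : (∏' k : ℕ, (1 - q ^ (N + 1) * (q ^ 2) ^ k)) ≠ 0 := by
    intro h0
    rw [h0, zero_mul] at hp
    exact nodeExp_one_ne_zero hq0 hq1 hp.symm
  have hl : lamQ q ^ (N + 1) * (1 - q ^ 2) = (1 - q ^ 2) ^ (1 - ((N : ℝ) + 1) / 2) := by
    rw [sub_eq_add_neg 1 (((N : ℝ) + 1) / 2), Real.rpow_add hQ, Real.rpow_one, mul_comm]
    congr 1
    rw [lamQ, Real.sqrt_eq_rpow, one_div, ← Real.rpow_neg_one, ← Real.rpow_mul hQ.le,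
      ← Real.rpow_natCast, ← Real.rpow_mul hQ.le]
    congr 1
    push_cast
    ring
  have hF : nodeSeries q (q ^ (N + 1))
      = nodeExp q 1 / ∏' k : ℕ, (1 - q ^ (N + 1) * (q ^ 2) ^ k) := by
    rw [eq_div_iff hP0, mul_comm, hp]
  rw [radial_one, qGamma, hP, ← nodeExp_one hq0 hq1, ← hF, ← hl, sq_rpow_half hq0]
  have h1 : q + 1 ≠ 0 := by positivity
  field_simp
  ring

/-! ### Orthogonality of the radial parts -/

/-- The weighted lowering operator `X ^ (s + 1) ↦ w (s + 1) X ^ s`, `1 ↦ 0`. -/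
def lower (w : ℕ → ℝ) (p : Polynomial ℝ) : Polynomial ℝ :=
  ∑ s ∈ Finset.range p.natDegree, Polynomial.monomial s (w (s + 1) * p.coeff (s + 1))

lemma coeff_lower (w : ℕ → ℝ) (p : Polynomial ℝ) (s : ℕ) :
    (lower w p).coeff s = w (s + 1) * p.coeff (s + 1) := by
  simp only [lower, Polynomial.finsetSum_coeff, Polynomial.coeff_monomial, Finset.sum_ite_eq',
    Finset.mem_range]
  split_ifs with h
  · rfl
  · rw [Polynomial.coeff_eq_zero_of_natDegree_lt (by omega), mul_zero]

lemma lower_add (w : ℕ → ℝ) (p g : Polynomial ℝ) : lower w (p + g) = lower w p + lower w g := by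
  ext s; simp [coeff_lower, mul_add]

lemma lower_monomial (w : ℕ → ℝ) (t : ℕ) (b : ℝ) :
    lower w (Polynomial.monomial (t + 1) b) = Polynomial.monomial t (w (t + 1) * b) := by
  ext s
  simp only [coeff_lower, Polynomial.coeff_monomial, add_left_inj, mul_ite, mul_zero]
  split_ifs with h
  · rw [h]
  · rfl

lemma lower_monomial_zero (w : ℕ → ℝ) (b : ℝ) : lower w (Polynomial.monomial 0 b) = 0 := by
  ext s; simp [coeff_lower]

/-- `h` is a polynomial of degree at most `j` with coefficient `a` in degree `j` that solves the
`q`-difference equation of the little `q`-Laguerre polynomials with parameter `β`, written as a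
recursion on coefficients. -/
structure IsQLaguerre (q β : ℝ) (j : ℕ) (a : ℝ) (h : Polynomial ℝ) : Prop where
  coeff_eq_zero : ∀ s, j < s → h.coeff s = 0
  coeff_top : h.coeff j = a
  recursion : ∀ s : ℕ, qNum q ((s : ℝ) + 1) * qNum q ((s : ℝ) + β) * h.coeff (s + 1)
    + qNum q s * h.coeff s = qNum q j / q ^ j * q ^ s * h.coeff s

/-- The moments of the radial weight satisfy a two-term recursion. -/
lemma radial_X_pow_succ (hq0 : 0 < q) (hq1 : q < 1) (N s : ℕ) :
    radial hq0 hq1 N (Polynomial.X ^ (s + 1))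
      = -(q ^ 2 * qNum (q ^ 2) ((s : ℝ) + ((N : ℝ) + 1) / 2))
        * radial hq0 hq1 N (Polynomial.X ^ s) := by
  induction s generalizing N with
  | zero =>
    rw [pow_succ', radial_X_mul, pow_zero, radial_add_two_one]
    simp
  | succ s ih =>
    rw [pow_succ' _ (s + 1), radial_X_mul, ih, pow_succ' _ s, radial_X_mul]
    push_cast
    rw [show (s : ℝ) + ((N : ℝ) + 2 + 1) / 2 = (s : ℝ) + 1 + ((N : ℝ) + 1) / 2 by ring]
    ring

/-- Partial `q`-integration: for a solution `h` of the `q`-Laguerre equation, the eigenvalue times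
the radial inner product of `h` and `g` is the next radial inner product of their
`q`-derivatives. -/
lemma IsQLaguerre.radial_mul (hq0 : 0 < q) (hq1 : q < 1) {N j : ℕ} {a : ℝ} {h : Polynomial ℝ}
    (hh : IsQLaguerre (q ^ 2) (((N : ℝ) + 1) / 2) j a h) (g : Polynomial ℝ) :
    qNum (q ^ 2) j / (q ^ 2) ^ j * radial hq0 hq1 N (h * g)
      = (q ^ 2) ^ (((N : ℝ) + 1) / 2)
        * radial hq0 hq1 (N + 2) (lower (fun s => qNum (q ^ 2) s) h
            * lower (fun s => qNum (q ^ 2) s) g) := by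
  set β : ℝ := ((N : ℝ) + 1) / 2 with hβ
  set w : ℕ → ℝ := fun s => qNum (q ^ 2) s with hw
  set v : ℕ → ℝ := fun s => radial hq0 hq1 N (Polynomial.X ^ s) with hv
  have hQ : 0 < q ^ 2 := pow_pos hq0 2
  have hsum : ∀ p : Polynomial ℝ, (∀ s, j < s → p.coeff s = 0) → ∀ (t : ℕ) (b : ℝ),
      radial hq0 hq1 N (p * Polynomial.monomial t b)
        = b * ∑ s ∈ Finset.range (j + 1), p.coeff s * v (s + t) := by
    intro p hp t b
    have hd : p.natDegree < j + 1 := by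
      rw [Nat.lt_succ_iff, Polynomial.natDegree_le_iff_coeff_eq_zero]
      exact hp
    rw [Polynomial.as_sum_range' p (j + 1) hd, Finset.sum_mul, map_sum, Finset.mul_sum,
      ← Polynomial.as_sum_range' p (j + 1) hd]
    refine Finset.sum_congr rfl fun s _ => ?_
    rw [Polynomial.monomial_mul_monomial, ← Polynomial.smul_X_eq_monomial, map_smul, smul_eq_mul]
    ring
  -- The two sides differ by a telescoping sum.
  have hkey : ∀ t : ℕ, qNum (q ^ 2) j / (q ^ 2) ^ j
        * ∑ s ∈ Finset.range (j + 1), h.coeff s * v (s + t)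
      = -((q ^ 2) ^ β * w t)
        * ∑ s ∈ Finset.range (j + 1), w (s + 1) * h.coeff (s + 1) * v (s + t) := by
    intro t
    set T : ℕ → ℝ := fun s => w s / (q ^ 2) ^ s * h.coeff s * v (s + t) with hT
    have h1 : ∀ s, qNum (q ^ 2) j / (q ^ 2) ^ j * (h.coeff s * v (s + t))
        + (q ^ 2) ^ β * w t * (w (s + 1) * h.coeff (s + 1) * v (s + t)) = T s - T (s + 1) := by
      intro s
      have hr := hh.recursion s
      have hvs : v (s + 1 + t) = -(q ^ 2 * qNum (q ^ 2) (((s + t : ℕ) : ℝ) + β)) * v (s + t) := by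
        rw [show s + 1 + t = s + t + 1 by ring]
        exact radial_X_pow_succ hq0 hq1 N (s + t)
      have hadd : qNum (q ^ 2) (((s + t : ℕ) : ℝ) + β)
          = qNum (q ^ 2) ((s : ℝ) + β) + (q ^ 2) ^ s * (q ^ 2) ^ β * w t := by
        rw [Nat.cast_add, show (s : ℝ) + t + β = s + β + t by ring, qNum_add hQ,
          Real.rpow_add hQ, Real.rpow_natCast]
      have hs : (q ^ 2) ^ s ≠ 0 := (pow_pos hQ s).ne'
      simp only [hT]
      rw [hvs, hadd, pow_succ (q ^ 2) s]
      have hr' : qNum (q ^ 2) j / (q ^ 2) ^ j * h.coeff s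
          = (w (s + 1) * qNum (q ^ 2) ((s : ℝ) + β) * h.coeff (s + 1) + w s * h.coeff s)
            / (q ^ 2) ^ s := by
        rw [eq_div_iff hs, hw]
        push_cast
        rw [hr]
        ring
      rw [← mul_assoc, hr']
      field_simp
      ring
    have h2 := Finset.sum_congr rfl fun s (_ : s ∈ Finset.range (j + 1)) => h1 s
    rw [Finset.sum_range_sub', Finset.sum_add_distrib, ← Finset.mul_sum, ← Finset.mul_sum] at h2
    have h3 : T 0 - T (j + 1) = 0 := by
      simp [hT, hw, qNum_zero, hh.coeff_eq_zero (j + 1) (Nat.lt_succ_self j)]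
    linarith
  induction g using Polynomial.induction_on' with
  | add g₁ g₂ h₁ h₂ => rw [mul_add, map_add, mul_add, h₁, h₂, lower_add, mul_add, map_add, mul_add]
  | monomial t b =>
    rw [hsum h hh.coeff_eq_zero, mul_left_comm, hkey]
    cases t with
    | zero => rw [lower_monomial_zero]; simp [hw, qNum_zero]
    | succ t =>
      have h4 := radial_X_mul hq0 hq1 N (lower w h * Polynomial.monomial t (w (t + 1) * b))
      rw [mul_left_comm, Polynomial.X_mul_monomial, hsum _ ?_] at h4
      · rw [lower_monomial, ← neg_eq_iff_eq_neg.mpr h4]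
        simp only [coeff_lower]
        ring
      · intro s hs
        rw [coeff_lower, hh.coeff_eq_zero (s + 1) (by omega), mul_zero]

/-- The `q`-derivative of a solution of degree `j + 1` with parameter `β` is a solution of degree
`j` with parameter `β + 1`. -/
lemma IsQLaguerre.lower (hq0 : 0 < q) {β : ℝ} {j : ℕ} {a : ℝ}
    {h : Polynomial ℝ} (hq1 : q < 1) (hh : IsQLaguerre q β (j + 1) a h) :
    IsQLaguerre q (β + 1) j (qNum q ((j : ℝ) + 1) * a) (lower (fun s => qNum q s) h) where
  coeff_eq_zero s hs := by rw [coeff_lower, hh.coeff_eq_zero (s + 1) (by omega), mul_zero]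
  coeff_top := by rw [coeff_lower, hh.coeff_top]; push_cast; rfl
  recursion s := by
    have hr := hh.recursion (s + 1)
    have h1 : qNum q 1 = 1 := by rw [qNum, Real.rpow_one, div_self (by linarith)]
    have hj : qNum q ((j + 1 : ℕ) : ℝ) = qNum q j + q ^ j := by
      rw [Nat.cast_add_one, qNum_add hq0, h1, Real.rpow_natCast, mul_one]
    have hs : qNum q ((s + 1 : ℕ) : ℝ) = qNum q s + q ^ s := by
      rw [Nat.cast_add_one, qNum_add hq0, h1, Real.rpow_natCast, mul_one]
    have hp : q ^ j ≠ 0 := (pow_pos hq0 j).ne'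
    have hμ : qNum q ((j + 1 : ℕ) : ℝ) / q ^ (j + 1) * q ^ (s + 1)
        = (qNum q j / q ^ j + 1) * q ^ s := by
      rw [hj, pow_succ, pow_succ]
      field_simp
    rw [hμ] at hr
    rw [coeff_lower, coeff_lower]
    rw [show (s : ℝ) + (β + 1) = ((s + 1 : ℕ) : ℝ) + β by push_cast; ring,
      ← Nat.cast_add_one (R := ℝ) s]
    have hr2 : qNum q (((s + 1 : ℕ) : ℝ) + 1) = qNum q ((s + 1 + 1 : ℕ) : ℝ) := by push_cast; rfl
    rw [hr2] at hr
    linear_combination qNum q ((s + 1 : ℕ) : ℝ) * hr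
      - qNum q ((s + 1 : ℕ) : ℝ) * h.coeff (s + 1) * hs

/-- Orthogonality and norms of the `q`-Laguerre polynomials for the radial functional. -/
lemma radial_mul_eq (hq0 : 0 < q) (hq1 : q < 1) {N j t : ℕ} {a b : ℝ} {h g : Polynomial ℝ}
    (hh : IsQLaguerre (q ^ 2) (((N : ℝ) + 1) / 2) j a h)
    (hg : IsQLaguerre (q ^ 2) (((N : ℝ) + 1) / 2) t b g) :
    radial hq0 hq1 N (h * g) = if j = t then
      a * b * ((q ^ 2) ^ (((j : ℝ) + 1) * ((j : ℝ) + ((N : ℝ) + 1) / 2)) * qFactorial (q ^ 2) j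
        * qGamma (q ^ 2) ((j : ℝ) + ((N : ℝ) + 1) / 2) / (q + 1)) else 0 := by
  have hQ : 0 < q ^ 2 := pow_pos hq0 2
  have hQ1 := sq_lt_one hq0 hq1
  have hconst : ∀ {N : ℕ} {a : ℝ} {h : Polynomial ℝ},
      IsQLaguerre (q ^ 2) (((N : ℝ) + 1) / 2) 0 a h → h = Polynomial.monomial 0 a := by
    intro N a h hh
    ext s
    cases s with
    | zero => simp [hh.coeff_top]
    | succ s => rw [hh.coeff_eq_zero _ (Nat.succ_pos s)]; simp
  have hzero : ∀ {N t : ℕ} {a b : ℝ} {h g : Polynomial ℝ},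
      IsQLaguerre (q ^ 2) (((N : ℝ) + 1) / 2) 0 a h →
      IsQLaguerre (q ^ 2) (((N : ℝ) + 1) / 2) (t + 1) b g → radial hq0 hq1 N (g * h) = 0 := by
    intro N t a b h g hh hg
    have h1 := hg.radial_mul hq0 hq1 h
    rw [hconst hh, lower_monomial_zero, mul_zero, map_zero, mul_zero] at h1
    rw [hconst hh]
    refine (mul_eq_zero.mp h1).resolve_left (div_pos (qNum_pos hQ hQ1 ?_) (pow_pos hQ _)).ne'
    positivity
  induction j generalizing N t a b h g with
  | zero =>
    cases t with
    | zero =>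
      have h1 : Polynomial.monomial (0 + 0) (a * b) = (a * b) • (1 : Polynomial ℝ) := by
        rw [Polynomial.smul_eq_C_mul, mul_one]; rfl
      rw [hconst hh, hconst hg, Polynomial.monomial_mul_monomial, if_pos rfl, h1, map_smul,
        radial_one_eq_qGamma, smul_eq_mul]
      simp [qFactorial]
    | succ t => rw [mul_comm, hzero hh hg, if_neg (Nat.succ_ne_zero t).symm]
  | succ j ih =>
    cases t with
    | zero => rw [hzero hg hh, if_neg (Nat.succ_ne_zero j)]
    | succ t =>
      have hN : ((N : ℝ) + 1) / 2 + 1 = (((N + 2 : ℕ) : ℝ) + 1) / 2 := by push_cast; ring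
      have h1 := hh.radial_mul hq0 hq1 g
      have hh' := hh.lower hQ hQ1
      have hg' := hg.lower hQ hQ1
      rw [hN] at hh' hg'
      rw [ih hh' hg'] at h1
      have hj : 0 < qNum (q ^ 2) ((j : ℝ) + 1) := qNum_pos hQ hQ1 (by positivity)
      have hμ : 0 < qNum (q ^ 2) ((j + 1 : ℕ) : ℝ) / (q ^ 2) ^ (j + 1) := by
        push_cast; positivity
      refine mul_left_cancel₀ hμ.ne' (h1.trans ?_)
      by_cases hjt : j = t
      · subst hjt
        simp only [if_true]
        have e1 : (j : ℝ) + (((N + 2 : ℕ) : ℝ) + 1) / 2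
            = ((j + 1 : ℕ) : ℝ) + ((N : ℝ) + 1) / 2 := by push_cast; ring
        rw [e1, qFactorial_succ]
        set β : ℝ := ((N : ℝ) + 1) / 2
        have e2 : (q ^ 2) ^ ((((j + 1 : ℕ) : ℝ) + 1) * (((j + 1 : ℕ) : ℝ) + β))
            = (q ^ 2) ^ β * (q ^ 2) ^ (j + 1)
              * (q ^ 2) ^ (((j : ℝ) + 1) * (((j + 1 : ℕ) : ℝ) + β)) := by
          rw [← Real.rpow_natCast (q ^ 2) (j + 1), ← Real.rpow_add hQ, ← Real.rpow_add hQ]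
          congr 1
          push_cast
          ring
        rw [e2, Nat.cast_add_one]
        field_simp
      · rw [if_neg hjt, if_neg (by omega)]
        simp

end Radial


open MeasureTheory

/-! ### Gaussian and spherical integrals of polynomials -/

/-- The integral of a real polynomial over the unit sphere. -/
def sphInt (m : ℕ) (P : MvPolynomial (Fin m) ℝ) : ℝ :=
  ∫ ξ : Metric.sphere (0 : EuclideanSpace ℝ (Fin m)) 1,
    MvPolynomial.eval (fun i => (ξ : EuclideanSpace ℝ (Fin m)) i) P
    ∂(volume : Measure (EuclideanSpace ℝ (Fin m))).toSphere

/-- The integral of a real polynomial against the Gaussian weight `exp (-r ^ 2)`. -/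
def gaussInt (m : ℕ) (P : MvPolynomial (Fin m) ℝ) : ℝ :=
  ∫ y : EuclideanSpace ℝ (Fin m), MvPolynomial.eval (fun i => y i) P * Real.exp (-‖y‖ ^ 2)

lemma integrable_pow_mul_exp (n : ℕ) : Integrable fun x : ℝ => x ^ n * Real.exp (-x ^ 2) := by
  have h := integrable_rpow_mul_exp_neg_mul_sq one_pos
    (s := (n : ℝ)) (by linarith [(Nat.cast_nonneg n : (0 : ℝ) ≤ n)])
  simpa only [Real.rpow_natCast, neg_mul, one_mul] using h

lemma two_mul_integral_pow_succ (n : ℕ) :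
    2 * ∫ x : ℝ, x ^ (n + 1) * Real.exp (-x ^ 2)
      = n * ∫ x : ℝ, x ^ (n - 1) * Real.exp (-x ^ 2) := by
  have hd : ∀ x : ℝ, HasDerivAt (fun x => x ^ n * Real.exp (-x ^ 2))
      (n * (x ^ (n - 1) * Real.exp (-x ^ 2)) - 2 * (x ^ (n + 1) * Real.exp (-x ^ 2))) x := by
    intro x
    have h := (hasDerivAt_pow n x).mul ((hasDerivAt_pow 2 x).neg.exp)
    refine h.congr_deriv ?_
    simp only [Pi.neg_apply]
    push_cast
    ring
  have h1 := (integrable_pow_mul_exp (n - 1)).const_mul (n : ℝ)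
  have h2 := (integrable_pow_mul_exp (n + 1)).const_mul 2
  have h := integral_eq_zero_of_hasDerivAt_of_integrable hd (h1.sub h2) (integrable_pow_mul_exp n)
  rw [integral_sub h1 h2, integral_const_mul, integral_const_mul] at h
  linarith

lemma eval_monomial_mul_exp {m : ℕ} (s : Fin m →₀ ℕ) (a : ℝ) (y : EuclideanSpace ℝ (Fin m)) :
    MvPolynomial.eval (fun i => y i) (MvPolynomial.monomial s a) * Real.exp (-‖y‖ ^ 2)
      = a * ∏ i, (y i ^ s i * Real.exp (-y i ^ 2)) := by
  rw [MvPolynomial.eval_monomial, Finsupp.prod_fintype _ _ (fun i => pow_zero _),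
    EuclideanSpace.real_norm_sq_eq, ← Finset.sum_neg_distrib, Real.exp_sum,
    Finset.prod_mul_distrib, mul_assoc]

lemma integrable_eval_mul_exp (m : ℕ) (P : MvPolynomial (Fin m) ℝ) :
    Integrable fun y : EuclideanSpace ℝ (Fin m) =>
      MvPolynomial.eval (fun i => y i) P * Real.exp (-‖y‖ ^ 2) := by
  induction P using MvPolynomial.induction_on' with
  | monomial s a =>
    simp only [eval_monomial_mul_exp]
    refine Integrable.const_mul ?_ a
    have h := Integrable.fintype_prod (μ := fun _ : Fin m => (volume : Measure ℝ))
      fun i => integrable_pow_mul_exp (s i)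
    exact (PiLp.volume_preserving_ofLp (Fin m)).integrable_comp_of_integrable h
  | add p r hp hr =>
    simp only [map_add, add_mul]
    exact hp.add hr

lemma gaussInt_add (m : ℕ) (P R : MvPolynomial (Fin m) ℝ) :
    gaussInt m (P + R) = gaussInt m P + gaussInt m R := by
  simp only [gaussInt, map_add, add_mul]
  exact integral_add (integrable_eval_mul_exp m P) (integrable_eval_mul_exp m R)

lemma gaussInt_smul (m : ℕ) (c : ℝ) (P : MvPolynomial (Fin m) ℝ) :
    gaussInt m (c • P) = c * gaussInt m P := by
  simp only [gaussInt, MvPolynomial.smul_eval, mul_assoc]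
  exact integral_const_mul _ _

/-- The Gaussian integral as a linear functional. -/
def gaussIntₗ (m : ℕ) : MvPolynomial (Fin m) ℝ →ₗ[ℝ] ℝ where
  toFun := gaussInt m
  map_add' := gaussInt_add m
  map_smul' := gaussInt_smul m

lemma gaussInt_monomial {m : ℕ} (s : Fin m →₀ ℕ) (a : ℝ) :
    gaussInt m (MvPolynomial.monomial s a)
      = a * ∏ i, ∫ x : ℝ, x ^ s i * Real.exp (-x ^ 2) := by
  simp only [gaussInt, eval_monomial_mul_exp]
  rw [integral_const_mul, ← integral_fintype_prod_volume_eq_prod]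
  congr 1
  exact (PiLp.volume_preserving_ofLp (Fin m)).integral_comp
    (MeasurableEquiv.toLp 2 (Fin m → ℝ)).symm.measurableEmbedding
    fun x : Fin m → ℝ => ∏ i, (x i ^ s i * Real.exp (-x i ^ 2))

/-- Integration by parts against the Gaussian weight. -/
lemma two_mul_gaussInt_X_mul {m : ℕ} (j : Fin m) (P : MvPolynomial (Fin m) ℝ) :
    2 * gaussInt m (MvPolynomial.X j * P) = gaussInt m (MvPolynomial.pderiv j P) := by
  induction P using MvPolynomial.induction_on' with
  | monomial s a =>
    have h1 : MvPolynomial.X j * MvPolynomial.monomial s a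
        = MvPolynomial.monomial (s + Finsupp.single j 1) a := by
      rw [mul_comm, MvPolynomial.X, MvPolynomial.monomial_mul, mul_one]
    rw [h1, MvPolynomial.pderiv_monomial, gaussInt_monomial, gaussInt_monomial,
      ← Finset.mul_prod_erase _ _ (Finset.mem_univ j),
      ← Finset.mul_prod_erase _ _ (Finset.mem_univ j)]
    have h2 : ∏ i ∈ Finset.univ.erase j,
          ∫ x : ℝ, x ^ (s + Finsupp.single j 1 : Fin m →₀ ℕ) i * Real.exp (-x ^ 2)
        = ∏ i ∈ Finset.univ.erase j,
          ∫ x : ℝ, x ^ (s - Finsupp.single j 1 : Fin m →₀ ℕ) i * Real.exp (-x ^ 2) := by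
      refine Finset.prod_congr rfl fun i hi => ?_
      have hij : j ≠ i := (Finset.ne_of_mem_erase hi).symm
      simp [hij]
    rw [h2]
    generalize (∏ i ∈ Finset.univ.erase j,
      ∫ x : ℝ, x ^ (s - Finsupp.single j 1 : Fin m →₀ ℕ) i * Real.exp (-x ^ 2)) = A
    have h3 := two_mul_integral_pow_succ (s j)
    simp only [Finsupp.add_apply, Finsupp.tsub_apply, Finsupp.single_eq_same]
    linear_combination a * A * h3
  | add p r hp hr => rw [mul_add, gaussInt_add, mul_add, hp, hr, map_add, gaussInt_add]

lemma eval_smul_of_isHomogeneous {m d : ℕ} {P : MvPolynomial (Fin m) ℝ} (hP : P.IsHomogeneous d)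
    (r : ℝ) (y : Fin m → ℝ) :
    MvPolynomial.eval (fun i => r * y i) P = r ^ d * MvPolynomial.eval y P := by
  rw [MvPolynomial.eval_eq', MvPolynomial.eval_eq', Finset.mul_sum]
  refine Finset.sum_congr rfl fun s hs => ?_
  have hd := hP (MvPolynomial.mem_support_iff.mp hs)
  rw [weight_one_eq_degree, Finsupp.degree_eq_sum] at hd
  simp only [mul_pow, Finset.prod_mul_distrib, Finset.prod_pow_eq_pow_sum, hd]
  ring

/-- Polar coordinates: on homogeneous polynomials of a fixed degree, the Gaussian integral is a
positive multiple of the integral over the sphere. -/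
lemma exists_gaussInt_eq {m : ℕ} (hm : 1 ≤ m) (d : ℕ) :
    ∃ c : ℝ, 0 < c ∧ ∀ P : MvPolynomial (Fin m) ℝ, P.IsHomogeneous d →
      gaussInt m P = sphInt m P * c := by
  let E := EuclideanSpace ℝ (Fin m)
  have : Nontrivial E := by
    have : Nonempty (Fin m) := ⟨⟨0, hm⟩⟩
    infer_instance
  let n := Module.finrank ℝ E - 1
  refine ⟨∫ r : Set.Ioi (0 : ℝ), (r : ℝ) ^ d * Real.exp (-(r : ℝ) ^ 2) ∂(.volumeIoiPow n), ?_, ?_⟩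
  · have h1 : ∫ r : Set.Ioi (0 : ℝ), (r : ℝ) ^ d * Real.exp (-(r : ℝ) ^ 2) ∂(.volumeIoiPow n)
        = ∫ r in Set.Ioi (0 : ℝ), r ^ ((n + d : ℕ) : ℝ) * Real.exp (-r ^ (2 : ℝ)) := by
      simp only [Measure.volumeIoiPow, ENNReal.ofReal]
      rw [integral_withDensity_eq_integral_smul,
        integral_subtype_comap measurableSet_Ioi
          fun a => Real.toNNReal (a ^ n) • (a ^ d * Real.exp (-a ^ 2)),
        setIntegral_congr_fun measurableSet_Ioi fun x hx => ?_]
      · have hx : 0 < x := hx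
        rw [NNReal.smul_def, Real.coe_toNNReal _ (pow_nonneg hx.le _), smul_eq_mul,
          Real.rpow_natCast, Real.rpow_two, pow_add, mul_assoc]
      · exact (measurable_subtype_coe.pow_const _).real_toNNReal
    have hn : (0 : ℝ) ≤ ((n + d : ℕ) : ℝ) := Nat.cast_nonneg _
    rw [h1, integral_rpow_mul_exp_neg_rpow two_pos (by linarith)]
    exact mul_pos (by norm_num) (Real.Gamma_pos_of_pos (by linarith))
  · intro P hP
    calc gaussInt m P
        = ∫ x : ({0}ᶜ : Set E), MvPolynomial.eval (fun i => (x : E) i) P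
            * Real.exp (-‖(x : E)‖ ^ 2) ∂((volume : Measure E).comap (↑)) := by
          rw [integral_subtype_comap (measurableSet_singleton _).compl
            fun x : E => MvPolynomial.eval (fun i => x i) P * Real.exp (-‖x‖ ^ 2),
            restrict_compl_singleton]
          rfl
      _ = ∫ x : Metric.sphere (0 : E) 1 × Set.Ioi (0 : ℝ),
            MvPolynomial.eval (fun i => (x.1 : E) i) P
              * ((x.2 : ℝ) ^ d * Real.exp (-(x.2 : ℝ) ^ 2))
            ∂((volume : Measure E).toSphere.prod (.volumeIoiPow n)) := by
          rw [← (volume : Measure E).measurePreserving_homeomorphUnitSphereProd.integral_comp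
            (Homeomorph.measurableEmbedding _)]
          refine integral_congr_ae (Filter.Eventually.of_forall fun x => ?_)
          have hx : ‖(x : E)‖ ≠ 0 := norm_ne_zero_iff.mpr x.2
          have h := eval_smul_of_isHomogeneous hP ‖(x : E)‖
            (fun i => (‖(x : E)‖⁻¹ • (x : E)) i)
          have hi : ∀ i, ‖(x : E)‖ * (‖(x : E)‖⁻¹ • (x : E)) i = (x : E) i :=
            fun i => mul_inv_cancel_left₀ hx _
          simp only [hi] at h
          simp only [homeomorphUnitSphereProd_apply_fst_coe, homeomorphUnitSphereProd_apply_snd_coe]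
          rw [h]
          ring
      _ = _ := integral_prod_mul
            (fun ξ : Metric.sphere (0 : E) 1 => MvPolynomial.eval (fun i => (ξ : E) i) P)
            fun r : Set.Ioi (0 : ℝ) => (r : ℝ) ^ d * Real.exp (-(r : ℝ) ^ 2)

/-! ### Orthogonality of spherical monogenics on the sphere -/

lemma IsSphericalMonogenic.mem_cHomog {m k : ℕ} {F : CPoly m} (hF : IsSphericalMonogenic m k F) :
    F ∈ cHomog m k := mem_cHomog_of_euler hF.2

lemma vecVar_mem_cHomog (m : ℕ) : vecVar m ∈ cHomog m 1 :=
  mem_cHomog_of_euler (by rw [euler_vecVar, Nat.cast_one, one_smul])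

lemma euler_vecVar_mul {m k : ℕ} {F : CPoly m} (hF : euler m F = (k : ℝ) • F) :
    euler m (vecVar m * F) = ((k + 1 : ℕ) : ℝ) • (vecVar m * F) := by
  rw [euler_mul, euler_vecVar, hF, mul_smul_comm, Nat.cast_add_one, add_smul, one_smul, add_comm]

/-- Stokes' formula for the Dirac operator with respect to the Gaussian weight. -/
lemma gaussInt_pairing_dirac (m : ℕ) (F G : CPoly m) :
    gaussIntₗ m (pairing m (dirac m F) G) - gaussIntₗ m (pairing m F (dirac m G))
      = 2 * gaussIntₗ m (pairing m F (vecVar m * G)) := by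
  rw [← map_sub, ← sum_pderiv_pairing_cgen_mul, ← sum_X_mul_pairing_cgen_mul, map_sum, map_sum,
    Finset.mul_sum]
  exact Finset.sum_congr rfl fun j _ => (two_mul_gaussInt_X_mul j _).symm

/-- Cauchy's theorem on the sphere. -/
lemma sphInt_pairing_vecVar_mul {m k l : ℕ} (hm : 1 ≤ m) {M N : CPoly m}
    (hM : IsSphericalMonogenic m k M) (hN : IsSphericalMonogenic m l N) :
    sphInt m (pairing m M (vecVar m * N)) = 0 := by
  have hx : vecVar m * N ∈ cHomog m (l + 1) := mem_cHomog_of_euler (euler_vecVar_mul hN.2)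
  obtain ⟨c, hc, h⟩ := exists_gaussInt_eq hm (k + (l + 1))
  have h1 := h _ (isHomogeneous_pairing hM.mem_cHomog hx)
  have h2 := gaussInt_pairing_dirac m M N
  simp only [hM.1, hN.1, map_zero, LinearMap.zero_apply, sub_zero] at h2
  have h3 : gaussInt m (pairing m M (vecVar m * N)) = 0 := by
    have : gaussIntₗ m (pairing m M (vecVar m * N)) = 0 := by linarith
    exact this
  rw [h3] at h1
  exact (mul_eq_zero.mp h1.symm).resolve_right hc.ne'

lemma gaussIntₗ_rSq_mul {m d : ℕ} {P : MvPolynomial (Fin m) ℝ} (hP : P.IsHomogeneous d) :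
    2 * gaussIntₗ m (rSq m * P) = (m + d) * gaussIntₗ m P := by
  have h : ∀ j, 2 * gaussIntₗ m (MvPolynomial.X j ^ 2 * P)
      = gaussIntₗ m (P + MvPolynomial.X j * MvPolynomial.pderiv j P) := by
    intro j
    rw [sq, mul_assoc]
    refine (two_mul_gaussInt_X_mul j _).trans ?_
    rw [Derivation.leibniz, MvPolynomial.pderiv_X_self, smul_eq_mul, smul_eq_mul, mul_one, add_comm]
    rfl
  rw [rSq, Finset.sum_mul, map_sum, Finset.mul_sum, Finset.sum_congr rfl fun j _ => h j, ← map_sum,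
    Finset.sum_add_distrib, hP.sum_X_mul_pderiv, Finset.sum_const, Finset.card_univ,
    Fintype.card_fin, map_add, map_nsmul, map_nsmul, nsmul_eq_mul, nsmul_eq_mul]
  ring

/-- Spherical monogenics of different degrees are orthogonal on the sphere. -/
lemma sphInt_pairing_eq_zero {m k l : ℕ} (hm : 1 ≤ m) (hkl : k ≠ l) {M N : CPoly m}
    (hM : IsSphericalMonogenic m k M) (hN : IsSphericalMonogenic m l N) :
    sphInt m (pairing m M N) = 0 := by
  have hh := isHomogeneous_pairing hM.mem_cHomog hN.mem_cHomog
  obtain ⟨c, hc, h⟩ := exists_gaussInt_eq hm (k + l)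
  have h1 : gaussIntₗ m (pairing m M N) = sphInt m (pairing m M N) * c := h _ hh
  have h2 := gaussInt_pairing_dirac m M (vecVar m * N)
  have h3 : dirac m (vecVar m * N) = (2 * (l : ℝ) + m) • N := by
    have := dirac_vecVar_mul m N
    rw [hN.1, mul_zero, add_zero, hN.2, smul_smul, ← add_smul] at this
    exact this
  rw [hM.1, h3, map_zero, LinearMap.zero_apply, map_zero, zero_sub, vecVar_mul_vecVar_mul, map_neg,
    pairing_smul_right, map_neg, mul_neg, gaussIntₗ_rSq_mul hh, map_smul, map_smul,
    smul_eq_mul] at h2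
  have h4 : ((l : ℝ) - k) * gaussIntₗ m (pairing m M N) = 0 := by
    push_cast at h2
    linarith
  have h5 : (l : ℝ) - k ≠ 0 := sub_ne_zero.mpr (by exact_mod_cast hkl.symm)
  rw [(mul_eq_zero.mp h4).resolve_left h5] at h1
  exact (mul_eq_zero.mp h1.symm).resolve_right hc.ne'

lemma sphereInner_eq_sphInt (m : ℕ) (F G : CPoly m) :
    sphereInner m F G = sphInt m (pairing m F G) := by
  simp only [sphereInner, sphInt, eval_pairing]

/-! ### The inner product as a product of a radial and a spherical integral -/

lemma qIntegrand_eq (q : ℝ) (m : ℕ) (F G : CPoly m) (y : EuclideanSpace ℝ (Fin m)) :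
    qIntegrand q m F G y
      = MvPolynomial.eval (fun i => y i) (pairing m F G) * qExp (q ^ 2) (-‖y‖ ^ 2) := by
  rw [qIntegrand, eval_pairing, Algebra.algebraMap_eq_smul_one, mul_smul_comm, mul_one,
    ← scalarPartₗ_apply, ← scalarPartₗ_apply, map_smul, smul_eq_mul, mul_comm]

lemma lamQ_nonneg (q : ℝ) : 0 ≤ lamQ q := Real.sqrt_nonneg _

lemma norm_node_smul {q : ℝ} (hq0 : 0 < q) {m : ℕ}
    (ξ : Metric.sphere (0 : EuclideanSpace ℝ (Fin m)) 1) (n : ℕ) :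
    ‖(lamQ q * q ^ n) • (ξ : EuclideanSpace ℝ (Fin m))‖ = lamQ q * q ^ n := by
  have h : ‖(ξ : EuclideanSpace ℝ (Fin m))‖ = 1 := by simp
  rw [norm_smul, h, mul_one, Real.norm_of_nonneg (mul_nonneg (lamQ_nonneg q) (by positivity))]

lemma qBallIntegrable_qIntegrand {q : ℝ} (hq0 : 0 < q) (hq1 : q < 1) (m : ℕ) (F G : CPoly m) :
    QBallIntegrable q m (lamQ q) (qIntegrand q m F G) := by
  let S := Metric.sphere (0 : EuclideanSpace ℝ (Fin m)) 1
  let P := pairing m F G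
  have hPc : Continuous fun y : EuclideanSpace ℝ (Fin m) => MvPolynomial.eval (fun i => y i) P :=
    (MvPolynomial.continuous_eval P).comp (by fun_prop)
  obtain ⟨A, hA⟩ := (isCompact_closedBall (0 : EuclideanSpace ℝ (Fin m))
    (lamQ q)).exists_bound_of_continuousOn hPc.continuousOn
  obtain ⟨C, hC0, hC⟩ := exists_nodeExp_bound hq0 hq1
  have hterm : ∀ (ξ : S) (n : ℕ),
      (lamQ q * q ^ n) ^ (m - 1) * qIntegrand q m F G ((lamQ q * q ^ n) •
        (ξ : EuclideanSpace ℝ (Fin m))) * q ^ n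
      = (lamQ q * q ^ n) ^ (m - 1) * (MvPolynomial.eval
        (fun i => ((lamQ q * q ^ n) • (ξ : EuclideanSpace ℝ (Fin m))) i) P * nodeExp q n)
        * q ^ n := by
    intro ξ n
    rw [qIntegrand_eq, norm_node_smul hq0, nodeExp]
  have hbound : ∀ (n : ℕ) (ξ : S),
      ‖(lamQ q * q ^ n) ^ (m - 1) * (MvPolynomial.eval
        (fun i => ((lamQ q * q ^ n) • (ξ : EuclideanSpace ℝ (Fin m))) i) P * nodeExp q n)
        * q ^ n‖ ≤ lamQ q ^ (m - 1) * (A * C) * q ^ n := by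
    intro n ξ
    have h1 : lamQ q * q ^ n ≤ lamQ q :=
      mul_le_of_le_one_right (lamQ_nonneg q) (pow_le_one₀ hq0.le hq1.le)
    have h0 : 0 ≤ lamQ q * q ^ n := mul_nonneg (lamQ_nonneg q) (by positivity)
    have h2 := hA ((lamQ q * q ^ n) • (ξ : EuclideanSpace ℝ (Fin m)))
      (by rw [mem_closedBall_zero_iff, norm_node_smul hq0]; exact h1)
    rw [norm_mul, norm_mul, norm_mul, Real.norm_of_nonneg (pow_nonneg hq0.le n),
      Real.norm_of_nonneg (pow_nonneg h0 _)]
    have hA0 := (norm_nonneg _).trans h2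
    have := lamQ_nonneg q
    gcongr
    exact hC n
  have hs : Summable fun n : ℕ => lamQ q ^ (m - 1) * (A * C) * q ^ n :=
    (summable_geometric_of_lt_one hq0.le hq1).mul_left _
  refine ⟨fun ξ => ?_, ?_⟩
  · simp only [hterm]
    exact Summable.of_norm_bounded hs fun n => hbound n ξ
  · have hc : Continuous fun ξ : S => ∑' n : ℕ, (lamQ q * q ^ n) ^ (m - 1) * (MvPolynomial.eval
        (fun i => ((lamQ q * q ^ n) • (ξ : EuclideanSpace ℝ (Fin m))) i) P * nodeExp q n)
        * q ^ n := by
      refine continuous_tsum (fun n => ?_) hs hbound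
      have h1 : Continuous fun ξ : S => MvPolynomial.eval
          (fun i => ((lamQ q * q ^ n) • (ξ : EuclideanSpace ℝ (Fin m))) i) P :=
        hPc.comp (by fun_prop)
      fun_prop
    simp only [jackson, hterm]
    exact (hc.integrable_of_hasCompactSupport (HasCompactSupport.of_compactSpace _)).const_mul _

/-- Separation of variables: if `[conj(F) G]_0 = p(-r ^ 2) K` with `K` homogeneous of degree `d`,
then `⟨F | G⟩` is the product of a radial functional of `p` and the integral of `K` over the
sphere. -/
lemma qInner_eq_radial_mul {q : ℝ} (hq0 : 0 < q) (hq1 : q < 1) {m d : ℕ} {F G : CPoly m}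
    {p : Polynomial ℝ} {K : MvPolynomial (Fin m) ℝ} (hK : K.IsHomogeneous d)
    (h : pairing m F G = Polynomial.aeval (-rSq m) p * K) :
    qInner q m F G = radial hq0 hq1 (m - 1 + d) p * sphInt m K := by
  rw [qInner, qBallIntegral, sphInt, ← integral_const_mul]
  congr 1
  funext ξ
  have hr : ∀ y : EuclideanSpace ℝ (Fin m),
      MvPolynomial.eval (fun i => y i) (Polynomial.aeval (-rSq m) p) = p.eval (-‖y‖ ^ 2) := by
    intro y
    have h1 : MvPolynomial.eval (fun i => y i) (-rSq m) = -‖y‖ ^ 2 := by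
      simp [rSq, EuclideanSpace.real_norm_sq_eq]
    have h2 : (MvPolynomial.eval fun i => y i).comp (algebraMap ℝ (MvPolynomial (Fin m) ℝ))
        = RingHom.id ℝ := by ext; simp
    rw [Polynomial.aeval_def, Polynomial.hom_eval₂, h1, h2]
    rfl
  rw [radial_apply, jackson, jackson, mul_assoc ((1 - q) * lamQ q), ← tsum_mul_right]
  congr 1
  refine tsum_congr fun n => ?_
  rw [qIntegrand_eq, norm_node_smul hq0, h, map_mul, hr, norm_node_smul hq0]
  have h2 := eval_smul_of_isHomogeneous hK (lamQ q * q ^ n)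
    (fun i => (ξ : EuclideanSpace ℝ (Fin m)) i)
  simp only [PiLp.smul_apply, smul_eq_mul]
  rw [h2]
  ring


/-! ### The `q`-Dirac operator on the functions `P(x) M` -/

lemma t2Space_weakTopology (V : Type) [AddCommGroup V] [Module ℝ V] :
    @T2Space V (weakTopology V) := by
  let : TopologicalSpace V := weakTopology V
  refine T2Space.of_injective_continuous (f := fun (v : V) (φ : Module.Dual ℝ V) => φ v) ?_ ?_
  · intro v w h
    rw [← sub_eq_zero, ← Module.forall_dual_apply_eq_zero_iff ℝ]
    intro φ
    rw [map_sub, sub_eq_zero]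
    exact congrFun h φ
  · exact continuous_pi fun φ => continuous_iInf_dom (i := φ) continuous_induced_dom

/-- On a finite sum of eigenvectors of `A`, the operator `[A]_q` acts through the `q`-numbers of
the eigenvalues. -/
lemma opQNum_sum {V ι : Type} [AddCommGroup V] [Module ℝ V] {q : ℝ} (hq0 : 0 < q)
    (A : Module.End ℝ V) (s : Finset ι) (v : ι → V) (μ : ι → ℝ) (h : ∀ i, A (v i) = μ i • v i) :
    opQNum q A (∑ i ∈ s, v i) = ∑ i ∈ s, qNum q (μ i) • v i := by
  have hpow : ∀ (n : ℕ) (i : ι), (A ^ n) (v i) = μ i ^ n • v i := by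
    intro n i
    induction n with
    | zero => simp
    | succ n ih => rw [pow_succ', Module.End.mul_apply, ih, map_smul, h, smul_smul, pow_succ]
  have hsum : opPow q A (∑ i ∈ s, v i) = ∑ i ∈ s, q ^ μ i • v i := by
    let : TopologicalSpace V := weakTopology V
    have : T2Space V := t2Space_weakTopology V
    refine HasSum.tsum_eq ?_
    rw [HasSum, nhds_iInf, Filter.tendsto_iInf]
    intro φ
    rw [nhds_induced, Filter.tendsto_comap_iff]
    have h1 : HasSum (fun n : ℕ => ∑ i ∈ s, (Real.log q * μ i) ^ n / (n.factorial : ℝ) * φ (v i))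
        (∑ i ∈ s, Real.exp (Real.log q * μ i) * φ (v i)) := by
      refine hasSum_sum fun i _ => HasSum.mul_right _ ?_
      rw [Real.exp_eq_exp_ℝ]
      exact NormedSpace.expSeries_div_hasSum_exp _
    have h2 : φ (∑ i ∈ s, q ^ μ i • v i) = ∑ i ∈ s, Real.exp (Real.log q * μ i) * φ (v i) := by
      simp [map_sum, Real.rpow_def_of_pos hq0]
    rw [h2]
    refine h1.congr fun t => ?_
    simp only [Function.comp_apply, map_sum, map_smul, hpow, smul_eq_mul, Finset.mul_sum, mul_pow]
    refine Finset.sum_congr rfl fun n _ => Finset.sum_congr rfl fun i _ => ?_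
    ring
  rw [opQNum, hsum, ← Finset.sum_sub_distrib, Finset.smul_sum]
  refine Finset.sum_congr rfl fun i _ => ?_
  rw [qNum, div_eq_inv_mul, mul_smul, sub_smul, one_smul]

/-- The eigenvalue of `x ∂` on `x ^ s M`, for a spherical monogenic `M` of degree `k`. -/
def theta (m k s : ℕ) : ℝ := if Even s then (s : ℝ) else (s : ℝ) - 1 + (2 * k + m)

lemma theta_zero (m k : ℕ) : theta m k 0 = 0 := by simp [theta]

lemma theta_succ (m k s : ℕ) : theta m k (s + 1) = 2 * ((s : ℝ) + k) + m - theta m k s := by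
  rcases Nat.even_or_odd s with h | h
  · have h1 : ¬Even (s + 1) := by simpa [Nat.even_add_one] using h
    simp [theta, h, h1]
    ring
  · have h0 : ¬Even s := Nat.not_even_iff_odd.mpr h
    have h1 : Even (s + 1) := by simpa [Nat.even_add_one] using h
    simp only [theta, h0, h1, if_true, if_false]
    push_cast
    ring

lemma euler_vecVar_pow_mul {m k : ℕ} {M : CPoly m} (hM : IsSphericalMonogenic m k M) (s : ℕ) :
    euler m (vecVar m ^ s * M) = ((k + s : ℕ) : ℝ) • (vecVar m ^ s * M) := by
  induction s with
  | zero => rw [pow_zero, one_mul, hM.2, add_zero]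
  | succ s ih => rw [pow_succ', mul_assoc, euler_vecVar_mul ih, add_assoc]

lemma vecDirac_vecVar_pow_mul {m k : ℕ} {M : CPoly m} (hM : IsSphericalMonogenic m k M) (s : ℕ) :
    vecDirac m (vecVar m ^ s * M) = theta m k s • (vecVar m ^ s * M) := by
  induction s with
  | zero => simp [vecDirac, hM.1, theta_zero]
  | succ s ih =>
    have h1 := dirac_vecVar_mul m (vecVar m ^ s * M)
    have h2 : vecVar m * dirac m (vecVar m ^ s * M) = theta m k s • (vecVar m ^ s * M) := ih
    rw [h2, euler_vecVar_pow_mul hM, smul_smul, ← add_smul, ← eq_sub_iff_add_eq, ← sub_smul] at h1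
    have h3 : vecDirac m (vecVar m ^ (s + 1) * M)
        = vecVar m * dirac m (vecVar m * (vecVar m ^ s * M)) := by
      rw [← mul_assoc, ← pow_succ']; rfl
    rw [h3, h1, mul_smul_comm, ← mul_assoc, ← pow_succ', theta_succ]
    congr 1
    push_cast
    ring

lemma aeval_vecVar_mul {m : ℕ} (P : Polynomial ℝ) {n : ℕ} (hn : P.natDegree < n) (M : CPoly m) :
    Polynomial.aeval (vecVar m) P * M
      = ∑ s ∈ Finset.range n, P.coeff s • (vecVar m ^ s * M) := by
  rw [Polynomial.aeval_eq_sum_range' hn, Finset.sum_mul]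
  exact Finset.sum_congr rfl fun s _ => smul_mul_assoc _ _ _

/-- The `q`-Dirac operator acts on `P(x) M` by lowering the powers of the vector variable. -/
lemma qDirac_aeval_mul {q : ℝ} (hq0 : 0 < q) {m k : ℕ} (hm : 1 ≤ m) {M : CPoly m}
    (hM : IsSphericalMonogenic m k M) (P : Polynomial ℝ) :
    qDirac m q (Polynomial.aeval (vecVar m) P * M)
      = Polynomial.aeval (vecVar m) (lower (fun s => qNum q (theta m k s)) P) * M := by
  set w : ℕ → ℝ := fun s => qNum q (theta m k s) with hw
  have hn : (Polynomial.X * lower w P).natDegree < P.natDegree + 1 := by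
    rw [Nat.lt_succ_iff, Polynomial.natDegree_le_iff_coeff_eq_zero]
    intro s hs
    obtain ⟨s, rfl⟩ : ∃ r, s = r + 1 := ⟨s - 1, by omega⟩
    rw [Polynomial.coeff_X_mul, coeff_lower, Polynomial.coeff_eq_zero_of_natDegree_lt hs, mul_zero]
  have hcoeff : ∀ s, (Polynomial.X * lower w P).coeff s = w s * P.coeff s := by
    intro s
    cases s with
    | zero => simp [hw, theta_zero, qNum_zero]
    | succ s => rw [Polynomial.coeff_X_mul, coeff_lower]
  have h : opQNum q (vecDirac m) (Polynomial.aeval (vecVar m) P * M)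
      = vecVar m * (Polynomial.aeval (vecVar m) (lower w P) * M) := by
    rw [aeval_vecVar_mul P (Nat.lt_succ_self _), opQNum_sum hq0 _ _ _ (theta m k),
      ← mul_assoc]
    · have h1 : vecVar m * Polynomial.aeval (vecVar m) (lower w P)
          = Polynomial.aeval (vecVar m) (Polynomial.X * lower w P) := by
        rw [map_mul, Polynomial.aeval_X]
      rw [h1, aeval_vecVar_mul _ hn]
      refine Finset.sum_congr rfl fun s _ => ?_
      rw [hcoeff, smul_smul]
    · intro s
      rw [map_smul, vecDirac_vecVar_pow_mul hM, smul_comm]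
  rw [qDirac, h]
  exact Function.leftInverse_invFun (vecVar_mul_injective hm) _

lemma vecVar_pow_mul_ne_zero {m : ℕ} (hm : 1 ≤ m) {M : CPoly m} (hM : M ≠ 0) (s : ℕ) :
    vecVar m ^ s * M ≠ 0 := by
  induction s with
  | zero => simpa using hM
  | succ s ih =>
    rw [pow_succ', mul_assoc]
    intro h
    exact ih (vecVar_mul_injective hm (h.trans (mul_zero _).symm))

/-- The functions `x ^ s M` are linearly independent, being homogeneous of different degrees. -/
lemma eq_zero_of_aeval_mul_eq_zero {m k : ℕ} (hm : 1 ≤ m) {M : CPoly m}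
    (hM : IsSphericalMonogenic m k M) (hM0 : M ≠ 0) {P : Polynomial ℝ}
    (h : Polynomial.aeval (vecVar m) P * M = 0) : P = 0 := by
  have hli : LinearIndependent ℝ fun s : ℕ => vecVar m ^ s * M := by
    refine Module.End.eigenvectors_linearIndependent' (euler m) (fun s : ℕ => ((k + s : ℕ) : ℝ)) ?_ _
      fun s => ⟨Module.End.mem_eigenspace_iff.mpr (euler_vecVar_pow_mul hM s),
        vecVar_pow_mul_ne_zero hm hM0 s⟩
    intro s t hst
    simpa using hst
  rw [aeval_vecVar_mul P (Nat.lt_succ_self _)] at h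
  ext s
  by_cases hs : s < P.natDegree + 1
  · exact linearIndependent_iff'.mp hli _ _ h s (Finset.mem_range.mpr hs)
  · exact Polynomial.coeff_eq_zero_of_natDegree_lt (by omega)

lemma dilate_aeval_mul {m k : ℕ} {M : CPoly m} (hM : IsSphericalMonogenic m k M) (q : ℝ)
    (P : Polynomial ℝ) :
    dilate m q (Polynomial.aeval (vecVar m) P * M)
      = Polynomial.aeval (vecVar m)
        (q ^ k • P.comp (Polynomial.C q * Polynomial.X)) * M := by
  rw [map_mul, dilate_of_mem_cHomog hM.mem_cHomog, ← Polynomial.aeval_algHom_apply,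
    dilate_of_mem_cHomog (vecVar_mem_cHomog m), map_smul, Polynomial.aeval_comp,
    ← Polynomial.smul_eq_C_mul, map_smul, Polynomial.aeval_X, pow_one, mul_smul_comm,
    smul_mul_assoc]

/-! ### The Clifford-Hermite equation as a recursion on coefficients -/

/-- The recursion on the coefficients of `H` that expresses the `q`-Clifford-Hermite equation with
eigenvalue `lam` for the function `H(x) M`, with `M` a spherical monogenic of degree `k`. -/
def HermiteRecursion (q : ℝ) (m k : ℕ) (lam : ℝ) (H : Polynomial ℝ) : Prop :=
  ∀ s : ℕ, qNum q (theta m k (s + 1)) * qNum q (theta m k (s + 2)) * H.coeff (s + 2)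
    + (q + 1) * qNum q (theta m k s) * H.coeff s = (q + 1) * lam * q ^ k * q ^ s * H.coeff s

/-- The polynomial `E` for which the two sides of the `q`-Clifford-Hermite equation differ by
`E(x) M`. -/
def hermiteDefect (q : ℝ) (m k : ℕ) (lam : ℝ) (H : Polynomial ℝ) : Polynomial ℝ :=
  -lower (fun s => qNum q (theta m k s)) (lower (fun s => qNum q (theta m k s)) H)
    - (q + 1) • (Polynomial.X * lower (fun s => qNum q (theta m k s)) H)
    + ((q + 1) * lam) • (q ^ k • H.comp (Polynomial.C q * Polynomial.X))

lemma hermiteDefect_eq_zero_iff (q : ℝ) (m k : ℕ) (lam : ℝ) (H : Polynomial ℝ) :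
    hermiteDefect q m k lam H = 0 ↔ HermiteRecursion q m k lam H := by
  rw [Polynomial.ext_iff]
  refine forall_congr' fun s => ?_
  have hX : (Polynomial.X * lower (fun s => qNum q (theta m k s)) H).coeff s
      = qNum q (theta m k s) * H.coeff s := by
    cases s with
    | zero => simp [theta_zero, qNum_zero]
    | succ s => rw [Polynomial.coeff_X_mul, coeff_lower]
  simp only [hermiteDefect, Polynomial.coeff_add, Polynomial.coeff_sub, Polynomial.coeff_neg,
    Polynomial.coeff_smul, hX, coeff_lower, Polynomial.comp_C_mul_X_coeff, smul_eq_mul,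
    Polynomial.coeff_zero]
  constructor <;> intro h <;> linear_combination -h

lemma hermite_equation_iff {q : ℝ} (hq0 : 0 < q) {m k : ℕ} (hm : 1 ≤ m) {M : CPoly m}
    (hM : IsSphericalMonogenic m k M) (lam : ℝ) (H : Polynomial ℝ) :
    qLaplace m q (Polynomial.aeval (vecVar m) H * M)
        - (q + 1) • (vecVar m * qDirac m q (Polynomial.aeval (vecVar m) H * M))
      = -((q + 1) * lam) • dilate m q (Polynomial.aeval (vecVar m) H * M)
    ↔ Polynomial.aeval (vecVar m) (hermiteDefect q m k lam H) * M = 0 := by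
  have h1 : ∀ P : Polynomial ℝ, vecVar m * (Polynomial.aeval (vecVar m) P * M)
      = Polynomial.aeval (vecVar m) (Polynomial.X * P) * M := fun P => by
    rw [map_mul, Polynomial.aeval_X, mul_assoc]
  have hE : Polynomial.aeval (vecVar m) (hermiteDefect q m k lam H) * M
      = -(Polynomial.aeval (vecVar m) (lower (fun s => qNum q (theta m k s))
          (lower (fun s => qNum q (theta m k s)) H)) * M)
        - (q + 1) • (Polynomial.aeval (vecVar m)
          (Polynomial.X * lower (fun s => qNum q (theta m k s)) H) * M)
        + ((q + 1) * lam) • (Polynomial.aeval (vecVar m)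
          (q ^ k • H.comp (Polynomial.C q * Polynomial.X)) * M) := by
    let L := LinearMap.mulRight ℝ M ∘ₗ (Polynomial.aeval (R := ℝ) (vecVar m)).toLinearMap
    change L (hermiteDefect q m k lam H) = -(L _) - (q + 1) • L _ + ((q + 1) * lam) • L _
    rw [hermiteDefect, map_add, map_sub, map_neg, map_smul, map_smul L ((q + 1) * lam)]
  rw [hE, qLaplace, qDirac_aeval_mul hq0 hm hM, qDirac_aeval_mul hq0 hm hM, dilate_aeval_mul hM,
    h1, cpoly_neg_smul, eq_neg_iff_add_eq_zero]

lemma qNum_two_mul {q : ℝ} (hq0 : 0 < q) (hq1 : q < 1) (u : ℝ) :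
    qNum q (2 * u) = (q + 1) * qNum (q ^ 2) u := by
  have h : (q ^ 2) ^ u = q ^ (2 * u) := by
    rw [← Real.rpow_natCast q 2, ← Real.rpow_mul hq0.le]; norm_num
  have h1 : q - 1 ≠ 0 := (sub_neg.mpr hq1).ne
  have h2 : q ^ 2 - 1 ≠ 0 := (sub_neg.mpr (sq_lt_one hq0 hq1)).ne
  rw [qNum, qNum, h]
  field_simp
  ring

lemma qNum_theta_even {q : ℝ} (hq0 : 0 < q) (hq1 : q < 1) (m k s : ℕ) :
    qNum q (theta m k (2 * s)) = (q + 1) * qNum (q ^ 2) s := by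
  rw [← qNum_two_mul hq0 hq1]; simp [theta]

lemma qNum_theta_odd {q : ℝ} (hq0 : 0 < q) (hq1 : q < 1) (m k s : ℕ) :
    qNum q (theta m k (2 * s + 1)) = (q + 1) * qNum (q ^ 2) ((s : ℝ) + ((m : ℝ) / 2 + k)) := by
  rw [← qNum_two_mul hq0 hq1]
  congr 1
  simp [theta]
  ring

lemma coeff_expand_two_even (h : Polynomial ℝ) (s : ℕ) :
    (Polynomial.expand ℝ 2 h).coeff (2 * s) = h.coeff s := by
  rw [mul_comm, Polynomial.coeff_expand_mul two_pos]

lemma coeff_expand_two_odd (h : Polynomial ℝ) (s : ℕ) :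
    (Polynomial.expand ℝ 2 h).coeff (2 * s + 1) = 0 := by
  rw [Polynomial.coeff_expand two_pos, if_neg (by omega)]

lemma hermiteRecursion_even_iff {q : ℝ} (hq0 : 0 < q) (hq1 : q < 1) (m k : ℕ) (lam : ℝ)
    (h : Polynomial ℝ) :
    HermiteRecursion q m k lam (Polynomial.expand ℝ 2 h) ↔
      ∀ s : ℕ, qNum (q ^ 2) ((s : ℝ) + 1) * qNum (q ^ 2) ((s : ℝ) + ((m : ℝ) / 2 + k))
        * h.coeff (s + 1) + qNum (q ^ 2) s * h.coeff s
        = lam * q ^ k / (q + 1) * (q ^ 2) ^ s * h.coeff s := by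
  have hq : q + 1 ≠ 0 := by positivity
  have key : ∀ s : ℕ, (qNum q (theta m k (2 * s + 1)) * qNum q (theta m k (2 * s + 2))
      * (Polynomial.expand ℝ 2 h).coeff (2 * s + 2)
      + (q + 1) * qNum q (theta m k (2 * s)) * (Polynomial.expand ℝ 2 h).coeff (2 * s)
      = (q + 1) * lam * q ^ k * q ^ (2 * s) * (Polynomial.expand ℝ 2 h).coeff (2 * s)) ↔
      qNum (q ^ 2) ((s : ℝ) + 1) * qNum (q ^ 2) ((s : ℝ) + ((m : ℝ) / 2 + k))
        * h.coeff (s + 1) + qNum (q ^ 2) s * h.coeff s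
        = lam * q ^ k / (q + 1) * (q ^ 2) ^ s * h.coeff s := by
    intro s
    rw [show 2 * s + 2 = 2 * (s + 1) by ring, qNum_theta_even hq0 hq1, qNum_theta_even hq0 hq1,
      qNum_theta_odd hq0 hq1, coeff_expand_two_even, coeff_expand_two_even, Nat.cast_add_one,
      pow_mul, ← mul_right_inj' (pow_ne_zero 2 hq) (b := _ + qNum (q ^ 2) s * h.coeff s)]
    have e : (q + 1) ^ 2 * (lam * q ^ k / (q + 1) * (q ^ 2) ^ s * h.coeff s)
        = (q + 1) * lam * q ^ k * (q ^ 2) ^ s * h.coeff s := by field_simp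
    rw [e]
    constructor <;> intro h <;> linear_combination h
  constructor
  · exact fun H s => (key s).mp (H (2 * s))
  · intro H s
    rcases Nat.even_or_odd' s with ⟨s, rfl | rfl⟩
    · exact (key s).mpr (H s)
    · rw [show 2 * s + 1 + 2 = 2 * (s + 1) + 1 by ring, coeff_expand_two_odd, coeff_expand_two_odd]
      ring

lemma hermiteRecursion_odd_iff {q : ℝ} (hq0 : 0 < q) (hq1 : q < 1) (m k : ℕ) (lam : ℝ)
    (h : Polynomial ℝ) :
    HermiteRecursion q m k lam (Polynomial.X * Polynomial.expand ℝ 2 h) ↔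
      ∀ s : ℕ, qNum (q ^ 2) ((s : ℝ) + 1) * qNum (q ^ 2) ((s : ℝ) + ((m : ℝ) / 2 + k + 1))
        * h.coeff (s + 1) + qNum (q ^ 2) ((s : ℝ) + ((m : ℝ) / 2 + k)) * h.coeff s
        = lam * q ^ k * q / (q + 1) * (q ^ 2) ^ s * h.coeff s := by
  have hq : q + 1 ≠ 0 := by positivity
  set H : Polynomial ℝ := Polynomial.X * Polynomial.expand ℝ 2 h with hH
  have hodd : ∀ s, H.coeff (2 * s + 1) = h.coeff s := fun s => by
    rw [hH, Polynomial.coeff_X_mul, coeff_expand_two_even]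
  have heven : ∀ s, H.coeff (2 * s) = 0 := fun s => by
    cases s with
    | zero => simp [hH]
    | succ s =>
      rw [show 2 * (s + 1) = 2 * s + 1 + 1 by ring, hH, Polynomial.coeff_X_mul,
        coeff_expand_two_odd]
  have key : ∀ s : ℕ, (qNum q (theta m k (2 * s + 1 + 1)) * qNum q (theta m k (2 * s + 1 + 2))
      * H.coeff (2 * s + 1 + 2) + (q + 1) * qNum q (theta m k (2 * s + 1)) * H.coeff (2 * s + 1)
      = (q + 1) * lam * q ^ k * q ^ (2 * s + 1) * H.coeff (2 * s + 1)) ↔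
      qNum (q ^ 2) ((s : ℝ) + 1) * qNum (q ^ 2) ((s : ℝ) + ((m : ℝ) / 2 + k + 1))
        * h.coeff (s + 1) + qNum (q ^ 2) ((s : ℝ) + ((m : ℝ) / 2 + k)) * h.coeff s
        = lam * q ^ k * q / (q + 1) * (q ^ 2) ^ s * h.coeff s := by
    intro s
    rw [show 2 * s + 1 + 2 = 2 * (s + 1) + 1 by ring, show 2 * s + 1 + 1 = 2 * (s + 1) by ring,
      qNum_theta_even hq0 hq1, qNum_theta_odd hq0 hq1, qNum_theta_odd hq0 hq1, hodd, hodd,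
      Nat.cast_add_one, pow_succ q (2 * s), pow_mul, show (s : ℝ) + 1 + ((m : ℝ) / 2 + k)
        = (s : ℝ) + ((m : ℝ) / 2 + k + 1) by ring,
      ← mul_right_inj' (pow_ne_zero 2 hq)
        (b := _ + qNum (q ^ 2) ((s : ℝ) + ((m : ℝ) / 2 + k)) * h.coeff s)]
    have e : (q + 1) ^ 2 * (lam * q ^ k * q / (q + 1) * (q ^ 2) ^ s * h.coeff s)
        = (q + 1) * lam * q ^ k * ((q ^ 2) ^ s * q) * h.coeff s := by field_simp
    rw [e]
    constructor <;> intro h <;> linear_combination h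
  constructor
  · exact fun H s => (key s).mp (H (2 * s + 1))
  · intro H' s
    rcases Nat.even_or_odd' s with ⟨s, rfl | rfl⟩
    · rw [show 2 * s + 2 = 2 * (s + 1) by ring, heven, heven]
      ring
    · exact (key s).mpr (H' s)

/-! ### Existence and shape of the Clifford-Hermite polynomials -/

/-- The polynomial `∑_{i ≤ j} a_i X ^ (j - i)`. -/
def revSum (a : ℕ → ℝ) (j : ℕ) : Polynomial ℝ :=
  ∑ i ∈ Finset.range (j + 1), Polynomial.C (a i) * Polynomial.X ^ (j - i)

lemma coeff_revSum (a : ℕ → ℝ) (j s : ℕ) :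
    (revSum a j).coeff s = if s ≤ j then a (j - s) else 0 := by
  simp only [revSum, Polynomial.finsetSum_coeff, Polynomial.coeff_C_mul, Polynomial.coeff_X_pow,
    mul_ite, mul_one, mul_zero]
  split_ifs with h
  · rw [Finset.sum_eq_single (j - s)]
    · rw [if_pos (by omega)]
    · intro i hi hne
      rw [Finset.mem_range] at hi
      rw [if_neg (by omega)]
    · intro hn
      rw [Finset.mem_range] at hn
      omega
  · exact Finset.sum_eq_zero fun i _ => if_neg (by omega)

lemma sum_eq_expand_revSum (a : ℕ → ℝ) (j : ℕ) :
    ∑ i ∈ Finset.range (2 * j / 2 + 1), Polynomial.C (a i) * Polynomial.X ^ (2 * j - 2 * i)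
      = Polynomial.expand ℝ 2 (revSum a j) := by
  rw [Nat.mul_div_cancel_left j two_pos, revSum, map_sum]
  refine Finset.sum_congr rfl fun i _ => ?_
  rw [map_mul, Polynomial.expand_C, map_pow, Polynomial.expand_X, ← pow_mul, Nat.mul_sub]

lemma sum_eq_X_mul_expand_revSum (a : ℕ → ℝ) (j : ℕ) :
    ∑ i ∈ Finset.range ((2 * j + 1) / 2 + 1),
        Polynomial.C (a i) * Polynomial.X ^ (2 * j + 1 - 2 * i)
      = Polynomial.X * Polynomial.expand ℝ 2 (revSum a j) := by
  rw [show (2 * j + 1) / 2 = j by omega, revSum, map_sum, Finset.mul_sum]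
  refine Finset.sum_congr rfl fun i hi => ?_
  rw [Finset.mem_range] at hi
  rw [map_mul, Polynomial.expand_C, map_pow, Polynomial.expand_X, ← pow_mul,
    show 2 * j + 1 - 2 * i = 2 * (j - i) + 1 by omega, pow_succ]
  ring

lemma exists_isQLaguerre {q : ℝ} (hq0 : 0 < q) (hq1 : q < 1) (β : ℝ) (j : ℕ) (c : ℝ) :
    ∃ a : ℕ → ℝ, a 0 = c ∧ IsQLaguerre q β j c (revSum a j) := by
  let a : ℕ → ℝ := fun i => Nat.rec c (fun i x =>
    qNum q (((j - (i + 1) : ℕ) : ℝ) + 1) * qNum q (((j - (i + 1) : ℕ) : ℝ) + β) * x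
      / (qNum q j / q ^ j * q ^ (j - (i + 1)) - qNum q ((j - (i + 1) : ℕ) : ℝ))) i
  have ha : ∀ i, a (i + 1) = qNum q (((j - (i + 1) : ℕ) : ℝ) + 1)
      * qNum q (((j - (i + 1) : ℕ) : ℝ) + β) * a i
      / (qNum q j / q ^ j * q ^ (j - (i + 1)) - qNum q ((j - (i + 1) : ℕ) : ℝ)) := fun i => rfl
  refine ⟨a, rfl, ⟨fun s hs => ?_, ?_, fun s => ?_⟩⟩
  · rw [coeff_revSum, if_neg (by omega)]
  · rw [coeff_revSum, if_pos le_rfl, Nat.sub_self]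
    rfl
  · rcases lt_trichotomy s j with hs | rfl | hs
    · obtain ⟨i, rfl⟩ : ∃ i, j = s + (i + 1) := ⟨j - s - 1, by omega⟩
      have hi := ha i
      rw [show s + (i + 1) - (i + 1) = s by omega] at hi
      rw [coeff_revSum, coeff_revSum, if_pos (by omega), if_pos (by omega),
        show s + (i + 1) - (s + 1) = i by omega, show s + (i + 1) - s = i + 1 by omega]
      -- The eigenvalues `[j]_q / q ^ j` are distinct.
      have hD : qNum q ((s + (i + 1) : ℕ) : ℝ) / q ^ (s + (i + 1)) * q ^ s - qNum q s ≠ 0 := by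
        have h1 : qNum q ((s + (i + 1) : ℕ) : ℝ)
            = qNum q ((i + 1 : ℕ) : ℝ) + q ^ (i + 1) * qNum q s := by
          rw [add_comm s, Nat.cast_add, qNum_add hq0, Real.rpow_natCast]
        have h2 : qNum q ((s + (i + 1) : ℕ) : ℝ) / q ^ (s + (i + 1)) * q ^ s - qNum q s
            = qNum q ((i + 1 : ℕ) : ℝ) / q ^ (i + 1) := by
          have h3 : q ^ s ≠ 0 := (pow_pos hq0 s).ne'
          have h4 : q ^ (i + 1) ≠ 0 := (pow_pos hq0 _).ne'
          rw [h1, pow_add q s]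
          field_simp
          ring
        rw [h2]
        exact (div_pos (qNum_pos hq0 hq1 (by positivity)) (pow_pos hq0 _)).ne'
      rw [eq_div_iff hD] at hi
      linear_combination -hi
    · have h3 : q ^ s ≠ 0 := (pow_pos hq0 s).ne'
      rw [coeff_revSum, coeff_revSum, if_neg (by omega)]
      field_simp
      ring
    · rw [coeff_revSum, coeff_revSum, if_neg (by omega), if_neg (by omega)]
      ring

/-- The recursion of the odd case becomes the `q`-Laguerre recursion, up to a shift of the
eigenvalue. -/
lemma qNum_shift {q : ℝ} (hq0 : 0 < q) (β : ℝ) (j s : ℕ) :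
    qNum q ((j : ℝ) + β) / q ^ j * q ^ s - qNum q ((s : ℝ) + β)
      = qNum q j / q ^ j * q ^ s - qNum q s := by
  have h1 : q ^ j ≠ 0 := (pow_pos hq0 j).ne'
  rw [qNum_add hq0, qNum_add hq0, Real.rpow_natCast, Real.rpow_natCast]
  field_simp
  ring

lemma exists_isCliffordHermite {q : ℝ} (hq0 : 0 < q) (hq1 : q < 1) {m : ℕ} (hm : 1 ≤ m)
    (j k : ℕ) : ∃ H : Polynomial ℝ, IsCliffordHermite q m j k H := by
  have hq : q + 1 ≠ 0 := by positivity
  have hk : q ^ k ≠ 0 := (pow_pos hq0 k).ne'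
  have hQ := pow_pos hq0 2
  rcases Nat.even_or_odd' j with ⟨j, rfl | rfl⟩
  · obtain ⟨a, ha, hL⟩ := exists_isQLaguerre hQ (sq_lt_one hq0 hq1)
      ((m : ℝ) / 2 + k) j ((q + 1) ^ (2 * j))
    refine ⟨Polynomial.expand ℝ 2 (revSum a j), ⟨a, ha, (sum_eq_expand_revSum a j).symm⟩,
      (q + 1) * (qNum (q ^ 2) j / (q ^ 2) ^ j) / q ^ k, fun M hM => ?_⟩
    rw [hermite_equation_iff hq0 hm hM, (hermiteDefect_eq_zero_iff _ _ _ _ _).mpr, map_zero,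
      zero_mul]
    rw [hermiteRecursion_even_iff hq0 hq1]
    intro s
    rw [hL.recursion s, div_mul_cancel₀ _ hk, mul_div_cancel_left₀ _ hq]
  · obtain ⟨a, ha, hL⟩ := exists_isQLaguerre hQ (sq_lt_one hq0 hq1)
      ((m : ℝ) / 2 + k + 1) j ((q + 1) ^ (2 * j + 1))
    refine ⟨Polynomial.X * Polynomial.expand ℝ 2 (revSum a j),
      ⟨a, ha, (sum_eq_X_mul_expand_revSum a j).symm⟩,
      (q + 1) * (qNum (q ^ 2) ((j : ℝ) + ((m : ℝ) / 2 + k)) / (q ^ 2) ^ j) / q / q ^ k,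
      fun M hM => ?_⟩
    rw [hermite_equation_iff hq0 hm hM, (hermiteDefect_eq_zero_iff _ _ _ _ _).mpr, map_zero,
      zero_mul]
    rw [hermiteRecursion_odd_iff hq0 hq1]
    intro s
    rw [div_mul_cancel₀ _ hk, div_mul_cancel₀ _ hq0.ne', mul_div_cancel_left₀ _ hq]
    linear_combination hL.recursion s
      - (revSum a j).coeff s * qNum_shift hQ ((m : ℝ) / 2 + k) j s

lemma IsCliffordHermite.exists_even {q : ℝ} {m j k : ℕ} {H : Polynomial ℝ}
    (hH : IsCliffordHermite q m (2 * j) k H) : ∃ h, H = Polynomial.expand ℝ 2 h := by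
  obtain ⟨⟨a, -, rfl⟩, -⟩ := hH
  exact ⟨_, sum_eq_expand_revSum a j⟩

lemma IsCliffordHermite.exists_odd {q : ℝ} {m j k : ℕ} {H : Polynomial ℝ}
    (hH : IsCliffordHermite q m (2 * j + 1) k H) :
    ∃ h, H = Polynomial.X * Polynomial.expand ℝ 2 h := by
  obtain ⟨⟨a, -, rfl⟩, -⟩ := hH
  exact ⟨_, sum_eq_X_mul_expand_revSum a j⟩

/-- If there are nonzero spherical monogenics of degree `k`, the coefficient recursion holds, and
comparing top coefficients identifies the eigenvalue. -/
lemma IsCliffordHermite.isQLaguerre_even {q : ℝ} (hq0 : 0 < q) (hq1 : q < 1) {m j k : ℕ}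
    (hm : 1 ≤ m) {M : CPoly m} (hM : IsSphericalMonogenic m k M) (hM0 : M ≠ 0)
    {h : Polynomial ℝ} (hH : IsCliffordHermite q m (2 * j) k (Polynomial.expand ℝ 2 h)) :
    IsQLaguerre (q ^ 2) ((m : ℝ) / 2 + k) j ((q + 1) ^ (2 * j)) h := by
  obtain ⟨⟨a, ha, haH⟩, lam, hlam⟩ := hH
  rw [sum_eq_expand_revSum] at haH
  obtain rfl : h = revSum a j := Polynomial.expand_injective two_pos haH
  have htop : (revSum a j).coeff j = (q + 1) ^ (2 * j) := by
    rw [coeff_revSum, if_pos le_rfl, Nat.sub_self, ha]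
  have hgt : ∀ s, j < s → (revSum a j).coeff s = 0 := fun s hs => by
    rw [coeff_revSum, if_neg (by omega)]
  have h1 := (hermiteDefect_eq_zero_iff _ _ _ _ _).mp (eq_zero_of_aeval_mul_eq_zero hm hM hM0
    ((hermite_equation_iff hq0 hm hM lam _).mp (hlam M hM)))
  rw [hermiteRecursion_even_iff hq0 hq1] at h1
  have hj : qNum (q ^ 2) j / (q ^ 2) ^ j = lam * q ^ k / (q + 1) := by
    have h2 := h1 j
    rw [hgt (j + 1) (Nat.lt_succ_self j), mul_zero, zero_add] at h2
    have h3 := mul_right_cancel₀ (by rw [htop]; positivity) h2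
    rw [h3, mul_div_cancel_right₀ _ (pow_pos (pow_pos hq0 2) j).ne']
  exact ⟨hgt, htop, fun s => by rw [h1 s, hj]⟩

lemma IsCliffordHermite.isQLaguerre_odd {q : ℝ} (hq0 : 0 < q) (hq1 : q < 1) {m j k : ℕ}
    (hm : 1 ≤ m) {M : CPoly m} (hM : IsSphericalMonogenic m k M) (hM0 : M ≠ 0)
    {h : Polynomial ℝ}
    (hH : IsCliffordHermite q m (2 * j + 1) k (Polynomial.X * Polynomial.expand ℝ 2 h)) :
    IsQLaguerre (q ^ 2) ((m : ℝ) / 2 + k + 1) j ((q + 1) ^ (2 * j + 1)) h := by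
  obtain ⟨⟨a, ha, haH⟩, lam, hlam⟩ := hH
  rw [sum_eq_X_mul_expand_revSum] at haH
  obtain rfl : h = revSum a j :=
    Polynomial.expand_injective two_pos (mul_left_cancel₀ Polynomial.X_ne_zero haH)
  have htop : (revSum a j).coeff j = (q + 1) ^ (2 * j + 1) := by
    rw [coeff_revSum, if_pos le_rfl, Nat.sub_self, ha]
  have hgt : ∀ s, j < s → (revSum a j).coeff s = 0 := fun s hs => by
    rw [coeff_revSum, if_neg (by omega)]
  have h1 := (hermiteDefect_eq_zero_iff _ _ _ _ _).mp (eq_zero_of_aeval_mul_eq_zero hm hM hM0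
    ((hermite_equation_iff hq0 hm hM lam _).mp (hlam M hM)))
  rw [hermiteRecursion_odd_iff hq0 hq1] at h1
  have hj : qNum (q ^ 2) ((j : ℝ) + ((m : ℝ) / 2 + k)) / (q ^ 2) ^ j
      = lam * q ^ k * q / (q + 1) := by
    have h2 := h1 j
    rw [hgt (j + 1) (Nat.lt_succ_self j), mul_zero, zero_add] at h2
    have h3 := mul_right_cancel₀ (by rw [htop]; positivity) h2
    rw [h3, mul_div_cancel_right₀ _ (pow_pos (pow_pos hq0 2) j).ne']
  refine ⟨hgt, htop, fun s => ?_⟩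
  have h2 := h1 s
  rw [← hj] at h2
  linear_combination h2
    + (revSum a j).coeff s * qNum_shift (pow_pos hq0 2) ((m : ℝ) / 2 + k) j s

/-! ### Inner products of Clifford-Hermite functions -/

lemma aeval_expand_two_mul {m : ℕ} (h : Polynomial ℝ) (F : CPoly m) :
    Polynomial.aeval (vecVar m) (Polynomial.expand ℝ 2 h) * F
      = Polynomial.aeval (-rSq m) h • F := by
  have hx : vecVar m ^ 2
      = (Algebra.TensorProduct.includeLeft : MvPolynomial (Fin m) ℝ →ₐ[ℝ] CPoly m) (-rSq m) := by
    rw [sq, vecVar_mul_vecVar, smul_eq_tmul_one_mul, mul_one,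
      Algebra.TensorProduct.includeLeft_apply, TensorProduct.neg_tmul]
  rw [Polynomial.expand_aeval, hx, Polynomial.aeval_algHom_apply, smul_eq_tmul_one_mul,
    Algebra.TensorProduct.includeLeft_apply]

lemma aeval_X_mul_expand_two_mul {m : ℕ} (h : Polynomial ℝ) (F : CPoly m) :
    Polynomial.aeval (vecVar m) (Polynomial.X * Polynomial.expand ℝ 2 h) * F
      = Polynomial.aeval (-rSq m) h • (vecVar m * F) := by
  rw [map_mul, Polynomial.aeval_X, mul_assoc, aeval_expand_two_mul, mul_smul_comm]

lemma qInner_even_even {q : ℝ} (hq0 : 0 < q) (hq1 : q < 1) {m k l : ℕ} {M N : CPoly m}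
    (hM : IsSphericalMonogenic m k M) (hN : IsSphericalMonogenic m l N) (h g : Polynomial ℝ) :
    qInner q m (Polynomial.aeval (vecVar m) (Polynomial.expand ℝ 2 h) * M)
        (Polynomial.aeval (vecVar m) (Polynomial.expand ℝ 2 g) * N)
      = radial hq0 hq1 (m - 1 + (k + l)) (h * g) * sphereInner m M N := by
  rw [sphereInner_eq_sphInt]
  refine qInner_eq_radial_mul hq0 hq1 (isHomogeneous_pairing hM.mem_cHomog hN.mem_cHomog) ?_
  rw [aeval_expand_two_mul, aeval_expand_two_mul, pairing_smul_left, pairing_smul_right, map_mul,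
    mul_assoc]

lemma qInner_odd_odd {q : ℝ} (hq0 : 0 < q) (hq1 : q < 1) {m k l : ℕ} {M N : CPoly m}
    (hM : IsSphericalMonogenic m k M) (hN : IsSphericalMonogenic m l N) (h g : Polynomial ℝ) :
    qInner q m (Polynomial.aeval (vecVar m) (Polynomial.X * Polynomial.expand ℝ 2 h) * M)
        (Polynomial.aeval (vecVar m) (Polynomial.X * Polynomial.expand ℝ 2 g) * N)
      = radial hq0 hq1 (m - 1 + (k + l) + 2) (h * g) * sphereInner m M N := by
  rw [sphereInner_eq_sphInt, ← neg_neg (radial hq0 hq1 (m - 1 + (k + l) + 2) (h * g)),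
    ← radial_X_mul, ← map_neg]
  refine qInner_eq_radial_mul hq0 hq1 (isHomogeneous_pairing hM.mem_cHomog hN.mem_cHomog) ?_
  rw [aeval_X_mul_expand_two_mul, aeval_X_mul_expand_two_mul, pairing_smul_left,
    pairing_smul_right, pairing_vecVar_mul, vecVar_mul_vecVar_mul, map_neg, pairing_smul_right,
    map_neg, map_mul, map_mul, Polynomial.aeval_X]
  ring

lemma qInner_odd_even {q : ℝ} (hq0 : 0 < q) (hq1 : q < 1) {m k l : ℕ} (hm : 1 ≤ m)
    {M N : CPoly m} (hM : IsSphericalMonogenic m k M) (hN : IsSphericalMonogenic m l N)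
    (h g : Polynomial ℝ) :
    qInner q m (Polynomial.aeval (vecVar m) (Polynomial.X * Polynomial.expand ℝ 2 h) * M)
        (Polynomial.aeval (vecVar m) (Polynomial.expand ℝ 2 g) * N) = 0 := by
  have hx : vecVar m * N ∈ cHomog m (l + 1) := mem_cHomog_of_euler (euler_vecVar_mul hN.2)
  rw [qInner_eq_radial_mul hq0 hq1 (p := -(h * g)) (isHomogeneous_pairing hM.mem_cHomog hx),
    sphInt_pairing_vecVar_mul hm hM hN, mul_zero]
  rw [aeval_X_mul_expand_two_mul, aeval_expand_two_mul, pairing_smul_left,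
    pairing_smul_right, pairing_vecVar_mul, map_neg, map_mul (Polynomial.aeval (-rSq m)) h g]
  ring

/-- A form of `radial_mul_eq` in which the parameter `(N + 1) / 2` is a variable. -/
lemma radial_mul_eq_of_dim {q : ℝ} (hq0 : 0 < q) (hq1 : q < 1) {N j t : ℕ} {a b β : ℝ}
    {h g : Polynomial ℝ} (hβ : ((N : ℝ) + 1) / 2 = β)
    (hh : IsQLaguerre (q ^ 2) β j a h) (hg : IsQLaguerre (q ^ 2) β t b g) :
    radial hq0 hq1 N (h * g) = if j = t then
      a * b * ((q ^ 2) ^ (((j : ℝ) + 1) * ((j : ℝ) + β)) * qFactorial (q ^ 2) j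
        * qGamma (q ^ 2) ((j : ℝ) + β) / (q + 1)) else 0 := by
  subst hβ
  exact radial_mul_eq hq0 hq1 hh hg

end
end QClifford

theorem mainTheorem3 (m : ℕ) (hm : 1 ≤ m) (q : ℝ) (hq0 : 0 < q) (hq1 : q < 1) :
    -- the inner product is given by convergent expressions
    (∀ F G : QClifford.CPoly m,
      QClifford.QBallIntegrable q m (QClifford.lamQ q) (QClifford.qIntegrand q m F G)) ∧
    -- the Clifford-Hermite polynomials exist
    (∀ j k : ℕ, ∃ H : Polynomial ℝ, QClifford.IsCliffordHermite q m j k H) ∧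
    -- orthogonality
    ∀ (H : ℕ → ℕ → Polynomial ℝ),
      (∀ j k : ℕ, QClifford.IsCliffordHermite q m j k (H j k)) →
      ∀ (d : ℕ → ℕ) (M : ℕ → ℕ → QClifford.CPoly m),
        (∀ k p : ℕ, p < d k → QClifford.IsSphericalMonogenic m k (M k p)) →
        (∀ k p r : ℕ, p < d k → r < d k →
          QClifford.sphereInner m (M k p) (M k r) = if p = r then 1 else 0) →
        ∀ j t k l p r n : ℕ, p < d k → r < d l → (n = k ∨ n = l) →
          QClifford.qInner q m
              (Polynomial.aeval (QClifford.vecVar m) (H (2 * j) k) * M k p)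
              (Polynomial.aeval (QClifford.vecVar m) (H (2 * t) n) * M l r)
            = (if j = t ∧ k = l ∧ p = r then
                (q + 1) ^ (4 * (j : ℤ) - 1)
                  * (q ^ 2) ^ (((j : ℝ) + 1) * ((j : ℝ) + ((m : ℝ) / 2 + (k : ℝ))))
                  * QClifford.qFactorial (q ^ 2) j
                  * QClifford.qGamma (q ^ 2) ((j : ℝ) + ((m : ℝ) / 2 + (k : ℝ)))
              else 0) ∧
          QClifford.qInner q m
              (Polynomial.aeval (QClifford.vecVar m) (H (2 * j + 1) k) * M k p)
              (Polynomial.aeval (QClifford.vecVar m) (H (2 * t + 1) n) * M l r)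
            = (if j = t ∧ k = l ∧ p = r then
                (q + 1) ^ (4 * (j : ℤ) + 1)
                  * (q ^ 2) ^ (((j : ℝ) + 1) * ((j : ℝ) + ((m : ℝ) / 2 + (k : ℝ)) + 1))
                  * QClifford.qFactorial (q ^ 2) j
                  * QClifford.qGamma (q ^ 2) ((j : ℝ) + ((m : ℝ) / 2 + (k : ℝ)) + 1)
              else 0) ∧
          QClifford.qInner q m
              (Polynomial.aeval (QClifford.vecVar m) (H (2 * j + 1) k) * M k p)
              (Polynomial.aeval (QClifford.vecVar m) (H (2 * t) n) * M l r) = 0 := by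
  refine ⟨QClifford.qBallIntegrable_qIntegrand hq0 hq1 m,
    QClifford.exists_isCliffordHermite hq0 hq1 hm, ?_⟩
  intro H hH d M hM hMM j t k l p r n hp hr hn
  have hMk := hM k p hp
  have hMl := hM l r hr
  obtain ⟨h₀, hh₀⟩ := (hH (2 * j) k).exists_even
  obtain ⟨g₀, hg₀⟩ := (hH (2 * t) n).exists_even
  obtain ⟨h₁, hh₁⟩ := (hH (2 * j + 1) k).exists_odd
  obtain ⟨g₁, hg₁⟩ := (hH (2 * t + 1) n).exists_odd
  -- `M k p` has norm one, so that the Clifford-Hermite equation for it is not vacuous.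
  have hM0 : M k p ≠ 0 := by
    intro h0
    have := hMM k p p hp hp
    simp [h0, QClifford.sphereInner_eq_sphInt, QClifford.sphInt] at this
  have hS : QClifford.sphereInner m (M k p) (M l r) = if k = l ∧ p = r then 1 else 0 := by
    by_cases hkl : k = l
    · subst hkl
      simp [hMM k p r hp hr]
    · rw [QClifford.sphereInner_eq_sphInt, QClifford.sphInt_pairing_eq_zero hm hkl hMk hMl,
        if_neg (fun h => hkl h.1)]
  refine ⟨?_, ?_, ?_⟩
  · rw [hh₀, hg₀, QClifford.qInner_even_even hq0 hq1 hMk hMl, hS]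
    by_cases hkp : k = l ∧ p = r
    · obtain ⟨rfl, rfl⟩ := hkp
      obtain rfl : n = k := by simpa using hn
      have hL := (hh₀ ▸ hH (2 * j) n).isQLaguerre_even hq0 hq1 hm hMk hM0
      have hL' := (hg₀ ▸ hH (2 * t) n).isQLaguerre_even hq0 hq1 hm hMk hM0
      rw [QClifford.radial_mul_eq_of_dim hq0 hq1 ?_ hL hL',
        if_pos (c := n = n ∧ p = p) ⟨rfl, rfl⟩, mul_one]
      · by_cases hjt : j = t
        · subst hjt
          rw [if_pos rfl, if_pos ⟨rfl, rfl, rfl⟩, zpow_sub₀ (by positivity), zpow_one,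
            show (4 * (j : ℤ)) = ((2 * j + 2 * j : ℕ) : ℤ) by push_cast; ring, zpow_natCast,
            pow_add]
          ring
        · rw [if_neg hjt, if_neg (fun h => hjt h.1)]
      · rw [Nat.cast_add, Nat.cast_sub hm]; push_cast; ring
    · rw [if_neg hkp, if_neg (fun h => hkp h.2), mul_zero]
  · rw [hh₁, hg₁, QClifford.qInner_odd_odd hq0 hq1 hMk hMl, hS]
    by_cases hkp : k = l ∧ p = r
    · obtain ⟨rfl, rfl⟩ := hkp
      obtain rfl : n = k := by simpa using hn
      have hL := (hh₁ ▸ hH (2 * j + 1) n).isQLaguerre_odd hq0 hq1 hm hMk hM0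
      have hL' := (hg₁ ▸ hH (2 * t + 1) n).isQLaguerre_odd hq0 hq1 hm hMk hM0
      rw [QClifford.radial_mul_eq_of_dim hq0 hq1 ?_ hL hL',
        if_pos (c := n = n ∧ p = p) ⟨rfl, rfl⟩, mul_one]
      · by_cases hjt : j = t
        · subst hjt
          have hq : q + 1 ≠ 0 := by positivity
          rw [if_pos rfl, if_pos ⟨rfl, rfl, rfl⟩, ← add_assoc (j : ℝ),
            show (4 * (j : ℤ) + 1) = ((4 * j + 1 : ℕ) : ℤ) by push_cast; ring, zpow_natCast]
          field_simp
          ring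
        · rw [if_neg hjt, if_neg (fun h => hjt h.1)]
      · rw [Nat.cast_add, Nat.cast_add, Nat.cast_sub hm]; push_cast; ring
    · rw [if_neg hkp, if_neg (fun h => hkp h.2), mul_zero]
  · rw [hh₁, hg₀, QClifford.qInner_odd_even hq0 hq1 hm hMk hMl]
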